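/- Let $k$ be an algebraically closed field of characteristic different from $2$. Let $D(\Lambda_2)$ be the Drinfel'd double of the $4$-dimensional Taft algebra, that is, the $k$-algebra generated by $x,X,g,G$ with relations \[ x^2=X^2=0,\quad g^2=G^2=1,\quad gG=Gg,\quad gx=-xg,\quad gX=-Xg,\quad Gx=-xG,\quad GX=-XG,\quad xX+Xx=1-gG, \] with the Hopf algebra structure in which $g$ and $G$ are grouplike, $\Delta(x)=1\otimes x+x\otimes g$, $\Delta(X)=1\otimes X+X\otimes G$, and the counit $\epsilon$ sends $g,G$ to $1$ and $x,X$ to $0$. Let $k$ also denote the trivial $D(\Lambda_2)$-module, and $k_-$ the one-dimensional module on which $g$ and $G$ act as $-1$ (and $x$, $X$ as $0$). For $(\alpha,\beta)\in k^2\setminus\{(0,0)\}$ let $H_{\alpha\beta}$ be the subalgebra of $D(\Lambda_2)$ generated by $g$, $G$ and $\alpha x+\beta X$. For a subalgebra $H$ of a Hopf algebra $\Lambda$, let $k_H$ be the one-dimensional $H$-module given by the restriction of the counit, and $k_H\!\uparrow^{\Lambda}\,=\Lambda\otimes_H k_H$. For $n\ge 1$, an element $\xi\in\operatorname{Ext}^n_\Lambda(M,N)$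 is said to be of induced type if it is represented by an exact sequence of $\Lambda$-modules \[ 0\to N\to L_{n-1}\otimes(k_{H_{n-1}}\!\uparrow^{\Lambda})\to\cdots\to L_0\otimes(k_{H_0}\!\uparrow^{\Lambda})\to M\to 0 \] for some finite-dimensional $\Lambda$-modules $L_0,\dots,L_{n-1}$ and some proper subalgebras $H_0,\dots,H_{n-1}$ of $\Lambda$, where $\Lambda$ acts on $\otimes=\otimes_k$ through the comultiplication; the $H_i$ are said to be involved. Then for every $n\ge 1$, every non-zero element of each of $\operatorname{Ext}^n_{D(\Lambda_2)}(k,k)$, $\operatorname{Ext}^n_{D(\Lambda_2)}(k,k_-)$, $\operatorname{Ext}^n_{D(\Lambda_2)}(k_-,k)$ and $\operatorname{Ext}^n_{D(\Lambda_2)}(k_-,k_-)$ is of induced type, with all the subalgebras involved of the form $H_{\alpha\beta}$, $(\alpha,\beta)\neq(0,0)$. -/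

import Mathlib

open scoped TensorProduct
open CategoryTheory

universe u

noncomputable section

/-! ## Modules over a Hopf algebra -/

section HopfModules

variable {k A : Type u} [Field k] [Ring A]

/-- The one-dimensional module `k` on which the `k`-algebra `A` acts through the character `χ`. -/
@[nolint unusedArguments]
def CharMod [Algebra k A] (_χ : A →ₐ[k] k) : Type u := k

section
variable [Algebra k A] (χ : A →ₐ[k] k)

instance : AddCommGroup (CharMod χ) := inferInstanceAs (AddCommGroup k)
instance : Module k (CharMod χ) := inferInstanceAs (Module k k)
instance : Module A (CharMod χ) := Module.compHom k χ.toRingHom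

theorem CharMod.smul_def (a : A) (v : CharMod χ) : a • v = χ a • v := rfl

instance : IsScalarTower k A (CharMod χ) where
  smul_assoc c a v := by
    rw [CharMod.smul_def, CharMod.smul_def, map_smul, smul_assoc]

end

/-- The trivial module `k_H` of a subalgebra `H`: the counit restricted to `H`. -/
abbrev TrivialMod [HopfAlgebra k A] (H : Subalgebra k A) : Type u :=
  CharMod ((Bialgebra.counitAlgHom k A).comp H.val)

/-- The induced module `V↑ = A ⊗_H V` of an `H`-module `V`, as the quotient of `A ⊗_k V` by the
`A`-submodule generated by the elements `a h ⊗ v - a ⊗ h v`. -/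
def Induced [Algebra k A] (H : Subalgebra k A) (V : Type u) [AddCommGroup V] [Module k V]
    [Module H V] : Type u :=
  (A ⊗[k] V) ⧸ Submodule.span A
    {t : A ⊗[k] V | ∃ (a : A) (h : H) (v : V), t = (a * (h : A)) ⊗ₜ[k] v - a ⊗ₜ[k] (h • v)}

section
variable [Algebra k A] (H : Subalgebra k A) (V : Type u) [AddCommGroup V] [Module k V] [Module H V]

instance : AddCommGroup (Induced H V) := by unfold Induced; infer_instance
instance : Module A (Induced H V) := by unfold Induced; infer_instance
instance : Module k (Induced H V) := by unfold Induced; infer_instance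
instance : IsScalarTower k A (Induced H V) := by unfold Induced; infer_instance

end

/-- The tensor product `L ⊗_k V` of two `A`-modules, with `A` acting through the
comultiplication: `a (l ⊗ v) = ∑ a₁ l ⊗ a₂ v`. -/
@[nolint unusedArguments]
def DiagTensor (k A : Type u) [Field k] [Ring A] [HopfAlgebra k A]
    (L V : Type u) [AddCommGroup L] [Module k L] [Module A L] [IsScalarTower k A L]
    [AddCommGroup V] [Module k V] [Module A V] [IsScalarTower k A V] : Type u :=
  L ⊗[k] V

section
variable [HopfAlgebra k A]
    (L V : Type u) [AddCommGroup L] [Module k L] [Module A L] [IsScalarTower k A L]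
    [AddCommGroup V] [Module k V] [Module A V] [IsScalarTower k A V]

/-- The algebra map `A → A ⊗ A → End L ⊗ End V → End (L ⊗ V)`. -/
def diagAction : A →ₐ[k] Module.End k (L ⊗[k] V) :=
  ((Module.endTensorEndAlgHom (R := k) (S := k) (A := k) (M := L) (N := V)).comp
    (Algebra.TensorProduct.map (Algebra.lsmul k k L) (Algebra.lsmul k k V))).comp
    (Bialgebra.comulAlgHom k A)

instance : AddCommGroup (DiagTensor k A L V) := inferInstanceAs (AddCommGroup (L ⊗[k] V))
instance : Module k (DiagTensor k A L V) := inferInstanceAs (Module k (L ⊗[k] V))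
instance : Module A (DiagTensor k A L V) :=
  Module.compHom (L ⊗[k] V) (diagAction (k := k) (A := A) L V).toRingHom

end

/-! ## Exact sequences and the elements of `Ext` they represent -/

/-- An exact sequence `0 → N → E_{n-1} → ⋯ → E_0 → M → 0` of `A`-modules, `n ≥ 1`, given as the
splice of the short exact sequences into which it decomposes. -/
inductive ExactSeq (N : ModuleCat.{u} A) : ModuleCat.{u} A → ℕ → Type (u + 1)
  /-- A short exact sequence `0 → N → E → M → 0`. -/
  | single {M E : ModuleCat.{u} A} (i : N ⟶ E) (p : E ⟶ M) (w : i ≫ p = 0)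
      (h : (ShortComplex.mk i p w).ShortExact) : ExactSeq N M 1
  /-- The splice of `0 → K → E → M → 0` with an exact sequence
  `0 → N → E_{n-1} → ⋯ → E_0 → K → 0`. -/
  | splice {M E K : ModuleCat.{u} A} {n : ℕ} (i : K ⟶ E) (p : E ⟶ M) (w : i ≫ p = 0)
      (h : (ShortComplex.mk i p w).ShortExact) (T : ExactSeq N K n) : ExactSeq N M (n + 1)

/-- The element of `Ext^n(M, N)` represented by an exact sequence
`0 → N → E_{n-1} → ⋯ → E_0 → M → 0`: the Yoneda product of the classes of its short exact
sequences. -/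
def ExactSeq.extClass {N : ModuleCat.{u} A} :
    {M : ModuleCat.{u} A} → {n : ℕ} → ExactSeq N M n → Abelian.Ext.{u} M N n
  | _, _, .single _ _ _ h => h.extClass
  | _, _, .splice _ _ _ h T => h.extClass.comp T.extClass (Nat.add_comm _ _)

/-- All the middle terms `E_0, …, E_{n-1}` of the exact sequence satisfy `P`. -/
def ExactSeq.AllTerms (P : ModuleCat.{u} A → Prop) {N : ModuleCat.{u} A} :
    {M : ModuleCat.{u} A} → {n : ℕ} → ExactSeq N M n → Prop
  | _, _, .single (E := E) _ _ _ _ => P E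
  | _, _, .splice (E := E) _ _ _ _ T => P E ∧ T.AllTerms P

/-- `ξ ∈ Ext^n(M, N)` is of induced type, with all the subalgebras involved in `𝒜`: it is
represented by an exact sequence whose `i`-th middle term is `L_i ⊗ (k_{H_i}↑)` for a
finite-dimensional module `L_i` and a proper subalgebra `H_i` in `𝒜`. -/
def IsOfInducedType [HopfAlgebra k A] (𝒜 : Set (Subalgebra k A)) {M N : ModuleCat.{u} A} {n : ℕ}
    (ξ : Abelian.Ext.{u} M N n) : Prop :=
  ∃ T : ExactSeq N M n, T.extClass = ξ ∧ T.AllTerms fun E =>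
    ∃ H ∈ 𝒜, H ≠ ⊤ ∧
    ∃ (L : Type u) (_ : AddCommGroup L) (_ : Module k L) (_ : Module A L)
      (_ : IsScalarTower k A L), Module.Finite k L ∧
      Nonempty (E ≃ₗ[A] DiagTensor k A L (Induced H (TrivialMod H)))

end HopfModules

/-! ## The Drinfel'd double of the Taft algebra of dimension four -/

namespace Taft

/-- The generators of the Drinfel'd double. -/
inductive Gen
  | x | X | g | G

section Presentation

variable (k : Type u) [Field k]

/-- A generator, in the free algebra. -/
abbrev fr (a : Gen) : FreeAlgebra k Gen := FreeAlgebra.ι k a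

/-- The defining relations of the Drinfel'd double. -/
inductive Rel : FreeAlgebra k Gen → FreeAlgebra k Gen → Prop
  | xx : Rel (fr k .x * fr k .x) 0
  | XX : Rel (fr k .X * fr k .X) 0
  | gg : Rel (fr k .g * fr k .g) 1
  | GG : Rel (fr k .G * fr k .G) 1
  | gG : Rel (fr k .g * fr k .G) (fr k .G * fr k .g)
  | gx : Rel (fr k .g * fr k .x) (-(fr k .x * fr k .g))
  | gX : Rel (fr k .g * fr k .X) (-(fr k .X * fr k .g))
  | Gx : Rel (fr k .G * fr k .x) (-(fr k .x * fr k .G))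
  | GX : Rel (fr k .G * fr k .X) (-(fr k .X * fr k .G))
  | xX : Rel (fr k .x * fr k .X + fr k .X * fr k .x) (1 - fr k .g * fr k .G)

end Presentation

/-- The Drinfel'd double `D(Λ₂)` of the Taft algebra `Λ₂` over `k`, by generators and relations. -/
def Double (k : Type u) [Field k] : Type u := RingQuot (Rel k)

section Structure

variable (k : Type u) [Field k]

instance : Ring (Double k) := inferInstanceAs (Ring (RingQuot (Rel k)))
instance : Algebra k (Double k) := inferInstanceAs (Algebra k (RingQuot (Rel k)))

/-- The image of a generator in the Drinfel'd double. -/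
def gen (a : Gen) : Double k := RingQuot.mkAlgHom k (Rel k) (FreeAlgebra.ι k a)

variable {k}

/-- The elements `v a` of `B` satisfy the defining relations. -/
structure SatisfiesRel {B : Type*} [Ring B] (v : Gen → B) : Prop where
  xx : v .x * v .x = 0
  XX : v .X * v .X = 0
  gg : v .g * v .g = 1
  GG : v .G * v .G = 1
  gG : v .g * v .G = v .G * v .g
  gx : v .g * v .x = -(v .x * v .g)
  gX : v .g * v .X = -(v .X * v .g)
  Gx : v .G * v .x = -(v .x * v .G)
  GX : v .G * v .X = -(v .X * v .G)
  xX : v .x * v .X + v .X * v .x = 1 - v .g * v .G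

theorem gen_satisfiesRel : SatisfiesRel (gen k) := by
  constructor <;> unfold gen
  · simpa using! RingQuot.mkAlgHom_rel k (Rel.xx (k := k))
  · simpa using! RingQuot.mkAlgHom_rel k (Rel.XX (k := k))
  · simpa using! RingQuot.mkAlgHom_rel k (Rel.gg (k := k))
  · simpa using! RingQuot.mkAlgHom_rel k (Rel.GG (k := k))
  · simpa using! RingQuot.mkAlgHom_rel k (Rel.gG (k := k))
  · simpa using! RingQuot.mkAlgHom_rel k (Rel.gx (k := k))
  · simpa using! RingQuot.mkAlgHom_rel k (Rel.gX (k := k))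
  · simpa using! RingQuot.mkAlgHom_rel k (Rel.Gx (k := k))
  · simpa using! RingQuot.mkAlgHom_rel k (Rel.GX (k := k))
  · simpa using! RingQuot.mkAlgHom_rel k (Rel.xX (k := k))

/-- The algebra map out of the Drinfel'd double given by elements satisfying the relations. -/
def lift {B : Type*} [Ring B] [Algebra k B] (v : Gen → B) (hv : SatisfiesRel v) :
    Double k →ₐ[k] B :=
  RingQuot.liftAlgHom k ⟨FreeAlgebra.lift k v, by
    intro a b h
    cases h
    · simpa using hv.xx
    · simpa using hv.XX
    · simpa using hv.gg
    · simpa using hv.GG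
    · simpa using hv.gG
    · simpa using hv.gx
    · simpa using hv.gX
    · simpa using hv.Gx
    · simpa using hv.GX
    · simpa using hv.xX⟩

@[simp]
theorem lift_gen {B : Type*} [Ring B] [Algebra k B] (v : Gen → B) (hv : SatisfiesRel v)
    (a : Gen) : lift (k := k) v hv (gen k a) = v a := by
  unfold lift gen
  erw [RingQuot.liftAlgHom_mkAlgHom_apply]
  simp

theorem algHom_ext {B : Type*} [Ring B] [Algebra k B] {f f' : Double k →ₐ[k] B}
    (h : ∀ a, f (gen k a) = f' (gen k a)) : f = f' := by
  apply RingQuot.ringQuot_ext' k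
  apply FreeAlgebra.hom_ext
  funext a
  exact h a

/-- The values of the comultiplication on the generators. -/
def comulGen : Gen → Double k ⊗[k] Double k
  | .x => 1 ⊗ₜ gen k .x + gen k .x ⊗ₜ gen k .g
  | .X => 1 ⊗ₜ gen k .X + gen k .X ⊗ₜ gen k .G
  | .g => gen k .g ⊗ₜ gen k .g
  | .G => gen k .G ⊗ₜ gen k .G

/-- The values of the counit on the generators. -/
def counitGen : Gen → k
  | .x => 0
  | .X => 0
  | .g => 1
  | .G => 1

/-- The values of the character of the module `k_-` on the generators. -/
def minusGen : Gen → k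
  | .x => 0
  | .X => 0
  | .g => -1
  | .G => -1

/-- The values of the antipode on the generators. -/
def antipodeGen : Gen → (Double k)ᵐᵒᵖ
  | .x => MulOpposite.op (-(gen k .x * gen k .g))
  | .X => MulOpposite.op (-(gen k .X * gen k .G))
  | .g => MulOpposite.op (gen k .g)
  | .G => MulOpposite.op (gen k .G)

theorem counitGen_satisfiesRel : SatisfiesRel (counitGen (k := k)) := by
  constructor <;> simp [counitGen]

theorem minusGen_satisfiesRel : SatisfiesRel (minusGen (k := k)) := by
  constructor <;> simp [minusGen]

theorem comulGen_satisfiesRel : SatisfiesRel (comulGen (k := k)) := by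
  have r := gen_satisfiesRel (k := k)
  constructor <;> simp only [comulGen, mul_add, add_mul, Algebra.TensorProduct.tmul_mul_tmul,
    one_mul, mul_one, r.xx, r.XX, r.gg, r.GG, r.gx, r.gX, r.Gx, r.GX,
    TensorProduct.tmul_zero, TensorProduct.zero_tmul, TensorProduct.tmul_neg,
    TensorProduct.neg_tmul, Algebra.TensorProduct.one_def, r.gG]
  · abel
  · abel
  · abel
  · abel
  · abel
  · abel
  · have h := r.xX
    have h1 : gen k .x * gen k .X = 1 - gen k .g * gen k .G - gen k .X * gen k .x := by
      rw [← h]; abel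
    rw [h1, r.gG]
    simp only [TensorProduct.tmul_sub, TensorProduct.sub_tmul]
    abel

/-- The comultiplication. -/
def comulHom : Double k →ₐ[k] Double k ⊗[k] Double k := lift comulGen comulGen_satisfiesRel

/-- The counit. -/
def counitHom : Double k →ₐ[k] k := lift counitGen counitGen_satisfiesRel

/-- The Drinfel'd double as a bialgebra: `g` and `G` are grouplike,
`Δ x = 1 ⊗ x + x ⊗ g`, `Δ X = 1 ⊗ X + X ⊗ G`, `ε g = ε G = 1` and `ε x = ε X = 0`. -/
instance : Bialgebra k (Double k) :=
  Bialgebra.ofAlgHom comulHom counitHom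
    (algHom_ext fun a => by
      cases a <;> simp [comulHom, comulGen, TensorProduct.tmul_add, TensorProduct.add_tmul,
        Algebra.TensorProduct.one_def, add_assoc])
    (algHom_ext fun a => by
      cases a <;> simp [comulHom, comulGen, counitHom, counitGen])
    (algHom_ext fun a => by
      cases a <;> simp [comulHom, comulGen, counitHom, counitGen])

theorem comul_apply (a : Double k) : Coalgebra.comul (R := k) a = comulHom a := rfl

theorem counit_apply (a : Double k) : Coalgebra.counit (R := k) a = counitHom a := rfl

theorem antipodeGen_satisfiesRel : SatisfiesRel (antipodeGen (k := k)) := by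
  have r := gen_satisfiesRel (k := k)
  have m : ∀ {a b c : Double k} (d : Double k), a * b = c → a * (b * d) = c * d :=
    fun d h => by rw [← mul_assoc, h]
  have h1 : gen k .x * gen k .X = 1 - gen k .g * gen k .G - gen k .X * gen k .x := by
    rw [← r.xX]; abel
  constructor <;> simp only [antipodeGen, ← MulOpposite.op_mul, ← MulOpposite.op_neg,
    ← MulOpposite.op_add, ← MulOpposite.op_one, ← MulOpposite.op_zero, ← MulOpposite.op_sub] <;>
    congr 1 <;>
    simp only [mul_assoc, neg_mul, mul_neg, neg_neg, r.gg, r.GG, r.xx, r.XX, r.gG,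
      m _ r.gG, m _ r.gx, m _ r.gX, m _ r.Gx, m _ r.GX, mul_one,
      neg_zero, m _ h1, sub_mul, one_mul]
  all_goals abel_nf

/-- The antipode: the antihomomorphism with `S g = g`, `S G = G`, `S x = -x g`, `S X = -X G`. -/
def antipodeHom : Double k →ₐ[k] (Double k)ᵐᵒᵖ := lift antipodeGen antipodeGen_satisfiesRel

theorem antipodeHom_gen (a : Gen) : antipodeHom (gen k a) = antipodeGen a := lift_gen _ _ a

/-- The map `a ⊗ b ↦ S(a) b`. -/
def convLeft : Double k ⊗[k] Double k →ₗ[k] Double k :=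
  LinearMap.mul' k (Double k) ∘ₗ
    ((MulOpposite.opLinearEquiv k).symm.toLinearMap ∘ₗ antipodeHom.toLinearMap).rTensor (Double k)

/-- The map `a ⊗ b ↦ a S(b)`. -/
def convRight : Double k ⊗[k] Double k →ₗ[k] Double k :=
  LinearMap.mul' k (Double k) ∘ₗ
    ((MulOpposite.opLinearEquiv k).symm.toLinearMap ∘ₗ antipodeHom.toLinearMap).lTensor (Double k)

theorem convLeft_tmul (a b : Double k) :
    convLeft (a ⊗ₜ b) = (antipodeHom a).unop * b := by
  simp [convLeft]

theorem convRight_tmul (a b : Double k) :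
    convRight (a ⊗ₜ b) = a * (antipodeHom b).unop := by
  simp [convRight]

theorem convLeft_mul (u t : Double k ⊗[k] Double k) (c : k)
    (hu : convLeft u = algebraMap k _ c) : convLeft (u * t) = c • convLeft t := by
  induction t using TensorProduct.induction_on with
  | zero => simp
  | add t t' h h' => rw [mul_add, map_add, h, h', map_add, smul_add]
  | tmul a b =>
    have key : ∀ u : Double k ⊗[k] Double k,
        convLeft (u * a ⊗ₜ b) = (antipodeHom a).unop * convLeft u * b := by
      intro u
      induction u using TensorProduct.induction_on with
      | zero => simp
      | add t t' h h' => rw [add_mul, map_add, h, h', map_add, mul_add, add_mul]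
      | tmul a' b' =>
        rw [Algebra.TensorProduct.tmul_mul_tmul, convLeft_tmul, convLeft_tmul]
        simp [mul_assoc]
    rw [key, hu, convLeft_tmul, ← Algebra.commutes, mul_assoc, Algebra.smul_def]

theorem convRight_mul (u t : Double k ⊗[k] Double k) (c : k)
    (ht : convRight t = algebraMap k _ c) : convRight (u * t) = c • convRight u := by
  induction u using TensorProduct.induction_on with
  | zero => simp
  | add t t' h h' => rw [add_mul, map_add, h, h', map_add, smul_add]
  | tmul a b =>
    have key : ∀ t : Double k ⊗[k] Double k,
        convRight (a ⊗ₜ b * t) = a * convRight t * (antipodeHom b).unop := by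
      intro u
      induction u using TensorProduct.induction_on with
      | zero => simp
      | add t t' h h' => rw [mul_add, map_add, h, h', map_add, mul_add, add_mul]
      | tmul a' b' =>
        rw [Algebra.TensorProduct.tmul_mul_tmul, convRight_tmul, convRight_tmul]
        simp [mul_assoc]
    rw [key, ht, convRight_tmul, ← Algebra.commutes, mul_assoc, Algebra.smul_def]

theorem double_induction {P : Double k → Prop} (h0 : ∀ c : k, P (algebraMap k _ c))
    (h1 : ∀ a, P (gen k a)) (hm : ∀ a b, P a → P b → P (a * b))
    (ha : ∀ a b, P a → P b → P (a + b)) (a : Double k) : P a := by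
  obtain ⟨b, rfl⟩ := RingQuot.mkAlgHom_surjective k (Rel k) a
  induction b using FreeAlgebra.induction with
  | grade0 c => exact (AlgHom.commutes (RingQuot.mkAlgHom k (Rel k)) c).symm ▸ h0 c
  | grade1 a => exact h1 a
  | mul a b h h' => exact (map_mul (RingQuot.mkAlgHom k (Rel k)) a b).symm ▸ hm _ _ h h'
  | add a b h h' => exact (map_add (RingQuot.mkAlgHom k (Rel k)) a b).symm ▸ ha _ _ h h'

theorem convLeft_comul (a : Double k) :
    convLeft (comulHom a) = algebraMap k (Double k) (counitHom a) := by
  have r := gen_satisfiesRel (k := k)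
  induction a using double_induction with
  | h0 c =>
    rw [AlgHom.commutes, AlgHom.commutes, Algebra.TensorProduct.algebraMap_apply, convLeft_tmul]
    simp
  | h1 a =>
    cases a <;> simp [comulHom, comulGen, counitHom, counitGen, convLeft_tmul,
      antipodeHom_gen, antipodeGen, mul_assoc, r.gg, r.GG]
  | hm a b h h' =>
    rw [map_mul, convLeft_mul _ _ _ h, h', map_mul, map_mul, Algebra.smul_def]
  | ha a b h h' => rw [map_add, map_add, h, h', map_add, map_add]

theorem convRight_comul (a : Double k) :
    convRight (comulHom a) = algebraMap k (Double k) (counitHom a) := by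
  have r := gen_satisfiesRel (k := k)
  induction a using double_induction with
  | h0 c =>
    rw [AlgHom.commutes, AlgHom.commutes, Algebra.TensorProduct.algebraMap_apply, convRight_tmul]
    simp
  | h1 a =>
    cases a <;> simp [comulHom, comulGen, counitHom, counitGen, convRight_tmul,
      antipodeHom_gen, antipodeGen, r.gg, r.GG]
  | hm a b h h' =>
    rw [map_mul, convRight_mul _ _ _ h', h, map_mul, map_mul, Algebra.smul_def, Algebra.commutes]
  | ha a b h h' => rw [map_add, map_add, h, h', map_add, map_add]

/-- The Drinfel'd double as a Hopf algebra. -/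
instance : HopfAlgebra k (Double k) where
  antipode := (MulOpposite.opLinearEquiv k).symm.toLinearMap ∘ₗ antipodeHom.toLinearMap
  mul_antipode_rTensor_comul := LinearMap.ext convLeft_comul
  mul_antipode_lTensor_comul := LinearMap.ext convRight_comul

variable (k)

/-- The subalgebra `H_{αβ}` generated by `g`, `G` and `αx + βX`. -/
def subalgH (α β : k) : Subalgebra k (Double k) :=
  Algebra.adjoin k {gen k .g, gen k .G, α • gen k .x + β • gen k .X}

/-- The set of all subalgebras `H_{αβ}`, for `α` and `β` not both zero. -/
def familyH : Set (Subalgebra k (Double k)) :=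
  {H | ∃ α β : k, (α, β) ≠ (0, 0) ∧ H = subalgH k α β}

/-- The trivial module `k`. -/
def plusMod : ModuleCat.{u} (Double k) :=
  ModuleCat.of (Double k) (CharMod (Bialgebra.counitAlgHom k (Double k)))

/-- The one-dimensional module `k_-`, on which `g` and `G` act as `-1`, and `x` and `X` as `0`. -/
def minusMod : ModuleCat.{u} (Double k) :=
  ModuleCat.of (Double k) (CharMod (lift (k := k) minusGen minusGen_satisfiesRel))

end Structure
end Taft
end

noncomputable section

/-! Let `S e` be the simple module on which `g` and `G` act as the sign `e`. Where `g` and `G` act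
alike, `gG = 1`, so `x` and `X` square to zero and anticommute: the modules in play are graded
modules over an exterior algebra in two variables. Koszul duality predicts that the extensions
between the `S e` form a polynomial ring in two classes of degree one, `a = eta e 1 0` and `b = eta
e 0 1`, so that a class of degree `n` is a binary form of degree `n`. Over an algebraically closed
field such a form is a product of linear forms, and a product of classes is represented by a splice.

The linear form `c a + d b` is the class of the two-dimensional module `Extn e c d`, whose generator
`w` has `x w` and `X w` equal to `c` and `d` times a socle vector. For `e = 1` this generator is
fixed by `g` and `G` and killed by `d x - c X`, and the module is induced from the trivial module of
`H_{d,-c}` (`Extn.exists_equiv_induced`); tensoring with `S e` gives the other sign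
(`Extn.exists_equiv_diagTensor`).

Of Koszul duality only two facts are needed, and not the linear independence of monomials.
Commutativity of `a` and `b` (`eta_comm`) is read off from the projective module `Proj e` with basis
`1, x, X, xX`. Generation by `a` and `b` (`exists_polyClass`) follows from the periodic resolution
of `Extn e 1 0` by the modules `Proj`, which leaves only the powers of `b`, and from the long exact
sequence of `0 → S (-e) → Extn e 1 0 → S e → 0`, whose connecting map is multiplication by `a`.

A form of degree `n` is stored as a polynomial of degree at most `n`, with `X^i` standing for
`a^(n-i) b^i`. Linear factors then come from roots, and `a` is the factor at infinity
(`exists_polyClass_eq_comp`). -/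

namespace Taft

/-! ### Representations given by operators -/

variable {k : Type u} [Field k]

/-- A `k`-module on which the generators act through the operators `v`. -/
@[nolint unusedArguments]
def Rep {V : Type u} [AddCommGroup V] [Module k V] (v : Gen → Module.End k V)
    (_hv : SatisfiesRel v) : Type u := V

section

variable {V : Type u} [AddCommGroup V] [Module k V] (v : Gen → Module.End k V)
  (hv : SatisfiesRel v)

instance : AddCommGroup (Rep v hv) := inferInstanceAs (AddCommGroup V)
instance : Module k (Rep v hv) := inferInstanceAs (Module k V)
instance : Module (Double k) (Rep v hv) := Module.compHom V (lift (k := k) v hv).toRingHom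

theorem Rep.smul_def (a : Double k) (m : Rep v hv) : a • m = lift (k := k) v hv a m := rfl

theorem Rep.gen_smul (a : Gen) (m : Rep v hv) : gen k a • m = v a m := by
  rw [Rep.smul_def, lift_gen]

instance : IsScalarTower k (Double k) (Rep v hv) where
  smul_assoc c a m := by
    rw [Rep.smul_def, map_smul]; rfl

end

section

variable {M N : Type u} [AddCommGroup M] [Module k M] [Module (Double k) M]
  [IsScalarTower k (Double k) M] [AddCommGroup N] [Module k N] [Module (Double k) N]
  [IsScalarTower k (Double k) N]

/-- A `k`-linear map commuting with the generators is linear over the Drinfel'd double. -/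
def linOfGen (f : M →ₗ[k] N) (hf : ∀ a m, f (gen k a • m) = gen k a • f m) :
    M →ₗ[Double k] N where
  toFun := f
  map_add' := map_add f
  map_smul' a := by
    induction a using double_induction with
    | h0 c => intro m; simp
    | h1 a => exact hf a
    | hm a b ha hb => intro m; rw [mul_smul, ha, hb]; simp [mul_smul]
    | ha a b ha hb => intro m; rw [add_smul, map_add, ha, hb]; simp [add_smul]

end

/-! ### The modules -/

/-- The image of a sign in `k`. -/
def sgn (k : Type u) [Field k] (e : ℤˣ) : k := ((e : ℤ) : k)

@[simp]
theorem sgn_mul_self (e : ℤˣ) : sgn k e * sgn k e = 1 := by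
  rcases Int.units_eq_one_or e with rfl | rfl <;> simp [sgn]

@[simp]
theorem sgn_mul_self_mul (e : ℤˣ) (a : k) : sgn k e * (sgn k e * a) = a := by
  rw [← mul_assoc, sgn_mul_self, one_mul]

/-- The values on the generators of the character with `g` and `G` acting as the sign `e`. -/
def signGen (k : Type u) [Field k] (e : ℤˣ) : Gen → k
  | .x => 0
  | .X => 0
  | .g => sgn k e
  | .G => sgn k e

theorem signGen_satisfiesRel (e : ℤˣ) : SatisfiesRel (signGen k e) := by
  constructor <;> simp [signGen]

/-- The character with `g` and `G` acting as the sign `e`. -/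
def signHom (k : Type u) [Field k] (e : ℤˣ) : Double k →ₐ[k] k :=
  lift (signGen k e) (signGen_satisfiesRel e)

/-- The simple module on which `g` and `G` act as the sign `e`. -/
abbrev S (k : Type u) [Field k] (e : ℤˣ) : Type u := CharMod (signHom k e)

theorem S_gen_smul (e : ℤˣ) (a : Gen) (m : S k e) :
    gen k a • m = (signGen k e a * (show k from m) : k) := by
  rw [CharMod.smul_def, signHom, lift_gen]; rfl

theorem plusMod_eq : plusMod k = ModuleCat.of (Double k) (S k 1) := by
  have : Bialgebra.counitAlgHom k (Double k) = signHom k 1 :=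
    algHom_ext fun a => by
      have : Bialgebra.counitAlgHom k (Double k) (gen k a) = counitHom (gen k a) := rfl
      rw [this]
      cases a <;> simp [counitHom, counitGen, signHom, signGen, sgn]
  rw [plusMod, this]

theorem minusMod_eq : minusMod k = ModuleCat.of (Double k) (S k (-1)) := by
  have : lift (k := k) minusGen minusGen_satisfiesRel = signHom k (-1) :=
    algHom_ext fun a => by cases a <;> simp [minusGen, signHom, signGen, sgn]
  rw [minusMod, this]

theorem sgn_neg (e : ℤˣ) : sgn k (-e) = -sgn k e := by simp [sgn]

section

variable {V : Type u} [AddCommGroup V] [Module k V]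

/-- The action of the generators by two operators `x`, `X` and an operator `s` for both
`g` and `G`. -/
def opGen (x X s : Module.End k V) : Gen → Module.End k V
  | .x => x
  | .X => X
  | .g => s
  | .G => s

/-- As `g` and `G` act by the same involution, `1 - gG` acts as zero and the last defining relation
becomes anticommutation of `x` and `X`. -/
theorem opGen_satisfiesRel {x X s : Module.End k V} (xx : ∀ m, x (x m) = 0)
    (XX : ∀ m, X (X m) = 0) (ss : ∀ m, s (s m) = m) (sx : ∀ m, s (x m) = -x (s m))
    (sX : ∀ m, s (X m) = -X (s m)) (xX : ∀ m, x (X m) + X (x m) = 0) :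
    SatisfiesRel (opGen x X s) := by
  have h : s * s = 1 := LinearMap.ext ss
  constructor <;> simp only [opGen, h, sub_self] <;>
    exact LinearMap.ext ‹_›

theorem opGen_comm {W : Type u} [AddCommGroup W] [Module k W] {x X s : Module.End k V}
    {x' X' s' : Module.End k W} {f : V → W} (hx : ∀ m, f (x m) = x' (f m))
    (hX : ∀ m, f (X m) = X' (f m)) (hs : ∀ m, f (s m) = s' (f m)) (a : Gen) (m : V) :
    f (opGen x X s a m) = opGen x' X' s' a (f m) := by
  cases a
  exacts [hx m, hX m, hs m, hs m]

end

/-- The operators of `g` and `G` on the sum of two copies of `S e`. -/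
def Dbl.s (e : ℤˣ) : Module.End k (k × k) where
  toFun m := (sgn k e * m.1, sgn k e * m.2)
  map_add' _ _ := by simp [mul_add]
  map_smul' _ _ := by simp [mul_left_comm]

theorem Dbl.rel (e : ℤˣ) : SatisfiesRel (opGen 0 0 (Dbl.s (k := k) e)) := by
  apply opGen_satisfiesRel <;> rintro ⟨a, b⟩ <;> simp [Dbl.s]

/-- The sum of two copies of `S e`. -/
abbrev Dbl (k : Type u) [Field k] (e : ℤˣ) : Type u := Rep _ (Dbl.rel (k := k) e)

/-- The operators of `g` and `G` on `Extn`. -/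
def Extn.s (e : ℤˣ) : Module.End k (k × k) where
  toFun m := (sgn k e * m.1, -(sgn k e * m.2))
  map_add' _ _ := by simp [mul_add, add_comm]
  map_smul' _ _ := by simp [mul_left_comm]

/-- The operator on `Extn` which maps the generator to `c` times a basis vector of the socle. -/
def Extn.r (c : k) : Module.End k (k × k) where
  toFun m := (0, c * m.1)
  map_add' _ _ := by simp [mul_add]
  map_smul' _ _ := by simp [mul_left_comm]

theorem Extn.rel (e : ℤˣ) (c d : k) :
    SatisfiesRel (opGen (Extn.r c) (Extn.r d) (Extn.s e)) := by
  apply opGen_satisfiesRel <;> rintro ⟨a, b⟩ <;> simp [Extn.s, Extn.r, mul_left_comm]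

/-- The extension of `S e` by `S (-e)` with coordinates `c, d`. -/
abbrev Extn (e : ℤˣ) (c d : k) : Type u := Rep _ (Extn.rel e c d)

/-- The operators of `g` and `G` on `Univ`. -/
def Univ.s (e : ℤˣ) : Module.End k (k × k × k) where
  toFun m := (sgn k e * m.1, -(sgn k e * m.2.1), -(sgn k e * m.2.2))
  map_add' _ _ := by simp [mul_add, add_comm]
  map_smul' _ _ := by simp [mul_left_comm]

/-- The operator of `x` on `Univ`. -/
def Univ.x : Module.End k (k × k × k) where
  toFun m := (0, m.1, 0)
  map_add' _ _ := by simp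
  map_smul' _ _ := by simp

/-- The operator of `X` on `Univ`. -/
def Univ.X : Module.End k (k × k × k) where
  toFun m := (0, 0, m.1)
  map_add' _ _ := by simp
  map_smul' _ _ := by simp

theorem Univ.rel (e : ℤˣ) : SatisfiesRel (opGen Univ.x Univ.X (Univ.s (k := k) e)) := by
  apply opGen_satisfiesRel <;> rintro ⟨a, b, c⟩ <;> simp [Univ.s, Univ.x, Univ.X]

/-- The universal extension of `S e` by copies of `S (-e)`. -/
abbrev Univ (k : Type u) [Field k] (e : ℤˣ) : Type u := Rep _ (Univ.rel (k := k) e)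

/-- The operators of `g` and `G` on `Proj`. -/
def Proj.s (e : ℤˣ) : Module.End k (k × k × k × k) where
  toFun m := (sgn k e * m.1, -(sgn k e * m.2.1), -(sgn k e * m.2.2.1), sgn k e * m.2.2.2)
  map_add' _ _ := by simp [mul_add, add_comm]
  map_smul' _ _ := by simp [mul_left_comm]

/-- The operator of `x` on `Proj`. -/
def Proj.x : Module.End k (k × k × k × k) where
  toFun m := (0, m.1, 0, m.2.2.1)
  map_add' _ _ := by simp
  map_smul' _ _ := by simp

/-- The operator of `X` on `Proj`. -/
def Proj.X : Module.End k (k × k × k × k) where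
  toFun m := (0, 0, m.1, -m.2.1)
  map_add' _ _ := by simp [add_comm]
  map_smul' _ _ := by simp

theorem Proj.rel (e : ℤˣ) : SatisfiesRel (opGen Proj.x Proj.X (Proj.s (k := k) e)) := by
  apply opGen_satisfiesRel <;> rintro ⟨a, b, c, d⟩ <;> simp [Proj.s, Proj.x, Proj.X]

/-- The projective cover of `S e`, with the basis `1, x, X, xX`. -/
abbrev Proj (k : Type u) [Field k] (e : ℤˣ) : Type u := Rep _ (Proj.rel (k := k) e)

/-! ### Homomorphisms and short exact sequences -/

section

variable {V : Type u} [AddCommGroup V] [Module k V] {x X s : Module.End k V}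
  {W : Type u} [AddCommGroup W] [Module k W] {x' X' s' : Module.End k W}

/-- Homomorphisms between modules given by operators. -/
def Rep.hom (h : SatisfiesRel (opGen x X s)) (h' : SatisfiesRel (opGen x' X' s')) (f : V →ₗ[k] W)
    (hx : ∀ m, f (x m) = x' (f m)) (hX : ∀ m, f (X m) = X' (f m))
    (hs : ∀ m, f (s m) = s' (f m)) : Rep _ h →ₗ[Double k] Rep _ h' :=
  linOfGen (show Rep _ h →ₗ[k] Rep _ h' from f) fun a m => by
    rw [Rep.gen_smul, Rep.gen_smul]
    exact opGen_comm hx hX hs a m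

/-- Homomorphisms out of a one-dimensional module. -/
def Rep.ofS (e : ℤˣ) (h : SatisfiesRel (opGen x X s)) (f : k →ₗ[k] V)
    (hx : ∀ m, x (f m) = 0) (hX : ∀ m, X (f m) = 0)
    (hs : ∀ m, s (f m) = sgn k e • f m) : S k e →ₗ[Double k] Rep _ h :=
  linOfGen (show S k e →ₗ[k] Rep _ h from f) fun a m => by
    rw [Rep.gen_smul, S_gen_smul]
    refine (map_smul f (signGen k e a) m).trans ?_
    cases a
    · exact (zero_smul k _).trans (hx m).symm
    · exact (zero_smul k _).trans (hX m).symm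
    · exact (hs m).symm
    · exact (hs m).symm

/-- Homomorphisms into a one-dimensional module. -/
def Rep.toS (e : ℤˣ) (h : SatisfiesRel (opGen x X s)) (f : V →ₗ[k] k)
    (hx : ∀ m, f (x m) = 0) (hX : ∀ m, f (X m) = 0)
    (hs : ∀ m, f (s m) = sgn k e * f m) : Rep _ h →ₗ[Double k] S k e :=
  linOfGen (show Rep _ h →ₗ[k] S k e from f) fun a m => by
    rw [Rep.gen_smul, S_gen_smul]
    cases a
    · exact (hx m).trans (zero_mul _).symm
    · exact (hX m).trans (zero_mul _).symm
    · exact hs m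
    · exact hs m

end

/-- The short exact sequence given by linear maps. -/
theorem shortExact_of {A : Type u} [Ring A] {M N L : Type u} [AddCommGroup M] [Module A M]
    [AddCommGroup N]
    [Module A N] [AddCommGroup L] [Module A L] (f : M →ₗ[A] N) (g : N →ₗ[A] L)
    (hf : Function.Injective f) (hg : Function.Surjective g) (h : ∀ n, g n = 0 → ∃ m, f m = n)
    (w : ModuleCat.ofHom f ≫ ModuleCat.ofHom g = 0) :
    (ShortComplex.mk (ModuleCat.ofHom f) (ModuleCat.ofHom g) w).ShortExact where
  exact := by
    rw [ShortComplex.moduleCat_exact_iff]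
    exact h
  mono_f := (ModuleCat.mono_iff_injective _).2 hf
  epi_g := (ModuleCat.epi_iff_surjective _).2 hg

/-- The inclusion of the socle of `Extn`. -/
def Extn.i (e : ℤˣ) (c d : k) : S k (-e) →ₗ[Double k] Extn e c d :=
  Rep.ofS (-e) (Extn.rel e c d) (LinearMap.inr k k k) (by simp [Extn.r]) (by simp [Extn.r])
    (by simp [Extn.s, sgn_neg])

/-- The projection of `Extn` onto its top. -/
def Extn.p (e : ℤˣ) (c d : k) : Extn e c d →ₗ[Double k] S k e :=
  Rep.toS e (Extn.rel e c d) (LinearMap.fst k k k) (by simp [Extn.r]) (by simp [Extn.r])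
    (by simp [Extn.s])

theorem Extn.w (e : ℤˣ) (c d : k) :
    ModuleCat.ofHom (Extn.i e c d) ≫ ModuleCat.ofHom (Extn.p e c d) = 0 := rfl

theorem Extn.shortExact (e : ℤˣ) (c d : k) : (ShortComplex.mk _ _ (Extn.w e c d)).ShortExact :=
  shortExact_of (Extn.i e c d) (Extn.p e c d) (fun _ _ h => congrArg Prod.snd h)
    (fun a => ⟨(a, (0 : k)), rfl⟩)
    (fun m h => ⟨m.2, Prod.ext (Eq.symm h) rfl⟩) _

/-- The inclusion of the socle of `Univ`. -/
def Univ.i (e : ℤˣ) : Dbl k (-e) →ₗ[Double k] Univ k e :=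
  Rep.hom (Dbl.rel (-e)) (Univ.rel e) (LinearMap.inr k k (k × k))
    (by simp [Univ.x, Prod.zero_eq_mk]) (by simp [Univ.X, Prod.zero_eq_mk])
    (by simp [Univ.s, Dbl.s, sgn_neg])

/-- The projection of `Univ` onto its top. -/
def Univ.p (e : ℤˣ) : Univ k e →ₗ[Double k] S k e :=
  Rep.toS e (Univ.rel e) (LinearMap.fst k k _) (by simp [Univ.x]) (by simp [Univ.X])
    (by simp [Univ.s])

theorem Univ.w (e : ℤˣ) :
    ModuleCat.ofHom (Univ.i (k := k) e) ≫ ModuleCat.ofHom (Univ.p e) = 0 := rfl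

theorem Univ.shortExact (e : ℤˣ) :
    (ShortComplex.mk _ _ (Univ.w (k := k) e)).ShortExact :=
  shortExact_of (Univ.i e) (Univ.p e) (fun _ _ h => congrArg Prod.snd h)
    (fun a => ⟨(a, (0 : k × k)), rfl⟩)
    (fun m h => ⟨m.2, Prod.ext (Eq.symm h) rfl⟩) _

/-- The inclusion of the socle of `Proj`. -/
def Proj.i (e : ℤˣ) : S k (- -e) →ₗ[Double k] Proj k e :=
  Rep.ofS (- -e) (Proj.rel e) (LinearMap.inr k k _ ∘ₗ LinearMap.inr k k _ ∘ₗ LinearMap.inr k k k)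
    (by simp [Proj.x]) (by simp [Proj.X]) (by simp [Proj.s])

/-- The quotient of `Proj` by its socle. -/
def Proj.p (e : ℤˣ) : Proj k e →ₗ[Double k] Univ k e :=
  Rep.hom (Proj.rel e) (Univ.rel e)
    (LinearMap.id.prodMap (LinearMap.id.prodMap (LinearMap.fst k k k)))
    (by simp [Proj.x, Univ.x]) (by simp [Proj.X, Univ.X]) (by simp [Proj.s, Univ.s])

theorem Proj.w (e : ℤˣ) :
    ModuleCat.ofHom (Proj.i (k := k) e) ≫ ModuleCat.ofHom (Proj.p e) = 0 := rfl

theorem Proj.shortExact (e : ℤˣ) :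
    (ShortComplex.mk _ _ (Proj.w (k := k) e)).ShortExact :=
  shortExact_of (Proj.i e) (Proj.p e)
    (fun _ _ h => congrArg (fun m : k × k × k × k => m.2.2.2) h)
    (fun m => ⟨(m.1, m.2.1, m.2.2, (0 : k)), rfl⟩)
    (fun m h => ⟨m.2.2.2, Prod.ext (congrArg Prod.fst h).symm (Prod.ext
      (congrArg (fun m : k × k × k => m.2.1) h).symm (Prod.ext
      (congrArg (fun m : k × k × k => m.2.2) h).symm rfl))⟩) _

/-- The kernel of the projection of `Proj` onto `Extn`. -/
def Proj.j (e : ℤˣ) : Extn (-e) (1 : k) 0 →ₗ[Double k] Proj k e :=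
  Rep.hom (Extn.rel (-e) 1 0) (Proj.rel e) (LinearMap.inr k k _ ∘ₗ LinearMap.inr k k _)
    (by simp [Proj.x, Extn.r]) (by simp [Proj.X, Extn.r]) (by simp [Proj.s, Extn.s, sgn_neg])

/-- The projection of `Proj` onto `Extn`. -/
def Proj.q (e : ℤˣ) : Proj k e →ₗ[Double k] Extn e (1 : k) 0 :=
  Rep.hom (Proj.rel e) (Extn.rel e 1 0)
    (LinearMap.id.prodMap (LinearMap.fst k k _))
    (by simp [Proj.x, Extn.r]) (by simp [Proj.X, Extn.r]) (by simp [Proj.s, Extn.s])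

theorem Proj.w' (e : ℤˣ) :
    ModuleCat.ofHom (Proj.j (k := k) e) ≫ ModuleCat.ofHom (Proj.q e) = 0 := rfl

theorem Proj.shortExact' (e : ℤˣ) :
    (ShortComplex.mk _ _ (Proj.w' (k := k) e)).ShortExact :=
  shortExact_of (Proj.j e) (Proj.q e) (fun _ _ h => congrArg (fun m : k × k × k × k => m.2.2) h)
    (fun m => ⟨(m.1, m.2, (0 : k × k)), rfl⟩)
    (fun m h => ⟨m.2.2, Prod.ext (congrArg Prod.fst h).symm (Prod.ext
      (congrArg Prod.snd h).symm rfl)⟩) _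

/-! ### Projectivity of `Proj` -/

/-- The primitive idempotent of sign `e`. -/
def idem (k : Type u) [Field k] (e : ℤˣ) : Double k :=
  (4⁻¹ : k) • ((1 + sgn k e • gen k .g) * (1 + sgn k e • gen k .G))

theorem mul_one_add_sgn {a : Double k} (h : a * a = 1) (e : ℤˣ) :
    a * (1 + sgn k e • a) = sgn k e • (1 + sgn k e • a) := by
  simp [mul_add, h, smul_smul, add_comm]

theorem g_mul_idem (e : ℤˣ) : gen k .g * idem k e = sgn k e • idem k e := by
  rw [idem, mul_smul_comm, ← mul_assoc, mul_one_add_sgn gen_satisfiesRel.gg, smul_mul_assoc,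
    smul_comm]

theorem G_mul_idem (e : ℤˣ) : gen k .G * idem k e = sgn k e • idem k e := by
  have h : gen k .G * (1 + sgn k e • gen k .g) = (1 + sgn k e • gen k .g) * gen k .G := by
    simp [mul_add, add_mul, gen_satisfiesRel.gG]
  rw [idem, mul_smul_comm, ← mul_assoc, h, mul_assoc, mul_one_add_sgn gen_satisfiesRel.GG,
    mul_smul_comm, smul_comm]

/-- The elements of `Proj`. -/
def Proj.mk (e : ℤˣ) (a b c d : k) : Proj k e := (a, b, c, d)

theorem Proj.x_smul (e : ℤˣ) (a b c d : k) :
    gen k .x • Proj.mk e a b c d = Proj.mk e 0 a 0 c := Rep.gen_smul _ _ _ _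

theorem Proj.X_smul (e : ℤˣ) (a b c d : k) :
    gen k .X • Proj.mk e a b c d = Proj.mk e 0 0 a (-b) := Rep.gen_smul _ _ _ _

theorem Proj.g_smul (e : ℤˣ) (a b c d : k) : gen k .g • Proj.mk e a b c d =
    Proj.mk e (sgn k e * a) (-(sgn k e * b)) (-(sgn k e * c)) (sgn k e * d) :=
  Rep.gen_smul _ _ _ _

theorem Proj.G_smul (e : ℤˣ) (a b c d : k) : gen k .G • Proj.mk e a b c d =
    Proj.mk e (sgn k e * a) (-(sgn k e * b)) (-(sgn k e * c)) (sgn k e * d) :=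
  Rep.gen_smul _ _ _ _

theorem Proj.smul_mk (e : ℤˣ) (t a b c d : k) :
    t • Proj.mk e a b c d = Proj.mk e (t * a) (t * b) (t * c) (t * d) := rfl

theorem Proj.mk_add_mk (e : ℤˣ) (a b c d a' b' c' d' : k) :
    Proj.mk e a b c d + Proj.mk e a' b' c' d' = Proj.mk e (a + a') (b + b') (c + c') (d + d') :=
  rfl

theorem Proj.forall_mk {e : ℤˣ} {P : Proj k e → Prop} (h : ∀ a b c d, P (Proj.mk e a b c d)) (m) :
    P m := h m.1 m.2.1 m.2.2.1 m.2.2.2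

/-- The embedding of `Proj` into the regular module, as a linear map over `k`. -/
def Proj.toRegularₗ (e : ℤˣ) : Proj k e →ₗ[k] Double k where
  toFun m := m.1 • idem k e + m.2.1 • (gen k .x * idem k e) +
    m.2.2.1 • (gen k .X * idem k e) + m.2.2.2 • (gen k .x * (gen k .X * idem k e))
  map_add' m m' := by
    change (m.1 + m'.1) • _ + (m.2.1 + m'.2.1) • _ + (m.2.2.1 + m'.2.2.1) • _ +
      (m.2.2.2 + m'.2.2.2) • _ = _
    module
  map_smul' c m := by
    change (c * m.1) • _ + (c * m.2.1) • _ + (c * m.2.2.1) • _ + (c * m.2.2.2) • _ = _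
    simp only [smul_add, smul_smul, RingHom.id_apply]

theorem Proj.toRegularₗ_mk (e : ℤˣ) (a b c d : k) : Proj.toRegularₗ e (Proj.mk e a b c d) =
    a • idem k e + b • (gen k .x * idem k e) +
    c • (gen k .X * idem k e) + d • (gen k .x * (gen k .X * idem k e)) := rfl

/-- The embedding of `Proj` into the regular module. -/
def Proj.toRegular (e : ℤˣ) : Proj k e →ₗ[Double k] Double k :=
  linOfGen (Proj.toRegularₗ e) (by
    have r := gen_satisfiesRel (k := k)
    have m : ∀ {a b c : Double k} (d : Double k), a * b = c → a * (b * d) = c * d :=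
      fun d h => by rw [← mul_assoc, h]
    -- Used to move `X` past `x` in front of `idem`, where `1 - gG` vanishes because `g` and `G` act
    -- by the same sign.
    have hX : gen k .X * gen k .x = 1 - gen k .g * gen k .G - gen k .x * gen k .X := by
      rw [← r.xX]; abel
    intro a
    refine Proj.forall_mk fun v v1 v2 v3 => ?_
    cases a <;> simp only [Proj.x_smul, Proj.X_smul, Proj.g_smul, Proj.G_smul,
      Proj.toRegularₗ_mk] <;> simp [mul_add, sub_mul, m _ r.xx, m _ r.XX, m _ hX,
      G_mul_idem, g_mul_idem, m _ r.gx, m _ r.gX, m _ r.Gx, m _ r.GX, smul_smul, mul_comm (sgn k e),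
      mul_assoc])

/-- The map from the regular module onto `Proj`. -/
def Proj.ofRegular (e : ℤˣ) : Double k →ₗ[Double k] Proj k e :=
  LinearMap.toSpanSingleton (Double k) (Proj k e) (Proj.mk e 1 0 0 0)

/-- Both factors of `idem` act on the generator as `1 + e² = 2`, which the coefficient `1/4`
cancels. -/
theorem Proj.idem_smul (h2 : (2 : k) ≠ 0) (e : ℤˣ) :
    idem k e • Proj.mk e (1 : k) 0 0 0 = Proj.mk e 1 0 0 0 := by
  have h4 : (4 : k) ≠ 0 := by
    rw [show (4 : k) = 2 * 2 by norm_num]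
    exact mul_ne_zero h2 h2
  simp only [idem, smul_assoc, mul_smul, add_smul, one_smul, Proj.g_smul, Proj.G_smul,
    Proj.smul_mk, Proj.mk_add_mk, mul_one, mul_zero, neg_zero, add_zero, sgn_mul_self]
  congr 1
  field_simp
  rw [pow_two, sgn_mul_self]
  norm_num

theorem Proj.ofRegular_toRegular (h2 : (2 : k) ≠ 0) (e : ℤˣ) (m : Proj k e) :
    Proj.ofRegular e (Proj.toRegular e m) = m := by
  have h := Proj.idem_smul h2 e
  change (Proj.toRegularₗ e m) • Proj.mk e (1 : k) 0 0 0 = m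
  revert m
  refine Proj.forall_mk fun v v1 v2 v3 => ?_
  simp [Proj.toRegularₗ_mk, add_smul, smul_assoc, mul_smul, h, Proj.x_smul, Proj.X_smul,
    Proj.smul_mk, Proj.mk_add_mk]

/-- `toRegular` and `ofRegular` make `Proj e` a direct summand of the regular module. The retraction
is checked inside `Proj e`, so no basis of the double is required. -/
theorem Proj.projective (h2 : (2 : k) ≠ 0) (e : ℤˣ) :
    Projective (ModuleCat.of (Double k) (Proj k e)) := by
  have : Module.Projective (Double k) (Proj k e) :=
    Module.Projective.of_split (Proj.toRegular e) (Proj.ofRegular e)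
      (LinearMap.ext (Proj.ofRegular_toRegular h2 e))
  exact (IsProjective.iff_projective _ ).1 this

/-! ### Extension classes -/

open Abelian

/-- The simple module `S e`, as an object of the category of modules. -/
abbrev SM (k : Type u) [Field k] (e : ℤˣ) : ModuleCat.{u} (Double k) :=
  ModuleCat.of (Double k) (S k e)

/-- A morphism of short exact sequences equates a pushout of the first class with a pullback of the
second. `omega_comp_pr`, `inc_comp_extClass` and `delta_comp_p` each come from one explicit
morphism. -/
theorem extClass_naturality_of {A : Type u} [Ring A] {M N L M' N' L' : Type u}
    [AddCommGroup M] [Module A M] [AddCommGroup N] [Module A N] [AddCommGroup L] [Module A L]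
    [AddCommGroup M'] [Module A M'] [AddCommGroup N'] [Module A N'] [AddCommGroup L'] [Module A L']
    {f : M →ₗ[A] N} {g : N →ₗ[A] L} {f' : M' →ₗ[A] N'} {g' : N' →ₗ[A] L'}
    {w : ModuleCat.ofHom f ≫ ModuleCat.ofHom g = 0}
    {w' : ModuleCat.ofHom f' ≫ ModuleCat.ofHom g' = 0}
    (h : (ShortComplex.mk (ModuleCat.ofHom f) (ModuleCat.ofHom g) w).ShortExact)
    (h' : (ShortComplex.mk (ModuleCat.ofHom f') (ModuleCat.ofHom g') w').ShortExact)
    (a : M →ₗ[A] M') (b : N →ₗ[A] N') (c : L →ₗ[A] L') (hab : ∀ m, f' (a m) = b (f m))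
    (hbc : ∀ m, g' (b m) = c (g m)) :
    h.extClass.comp (Ext.mk₀ (ModuleCat.ofHom a)) (add_zero 1) =
      (Ext.mk₀ (ModuleCat.ofHom c)).comp h'.extClass (zero_add 1) :=
  ShortComplex.ShortExact.extClass_naturality h h'
    { τ₁ := ModuleCat.ofHom a
      τ₂ := ModuleCat.ofHom b
      τ₃ := ModuleCat.ofHom c
      comm₁₂ := ModuleCat.hom_ext (LinearMap.ext hab)
      comm₂₃ := ModuleCat.hom_ext (LinearMap.ext hbc) }

/-- The class of the extension `Extn e c d`. -/
def eta (e : ℤˣ) (c d : k) : Ext.{u} (SM k e) (SM k (-e)) 1 :=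
  (Extn.shortExact e c d).extClass

/-- The class of the universal extension. -/
def omega (k : Type u) [Field k] (e : ℤˣ) :
    Ext.{u} (SM k e) (ModuleCat.of (Double k) (Dbl k (-e))) 1 :=
  (Univ.shortExact (k := k) e).extClass

/-- The homomorphism from `Dbl` to the simple module with coordinates `c, d`. -/
def Dbl.pr (e : ℤˣ) (c d : k) : Dbl k e →ₗ[Double k] S k e :=
  Rep.toS e (Dbl.rel e) (c • LinearMap.fst k k k + d • LinearMap.snd k k k) (by simp) (by simp)
    (by simp [Dbl.s]; intros; ring)

/-- The homomorphism from the simple module to `Dbl` with coordinates `c, d`. -/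
def Dbl.inc (e : ℤˣ) (c d : k) : S k e →ₗ[Double k] Dbl k e :=
  Rep.ofS e (Dbl.rel e) ((c • LinearMap.id).prod (d • LinearMap.id)) (by simp) (by simp)
    (by simp [Dbl.s])

theorem mk₀_ofHom_smul {M N : Type u} [AddCommGroup M] [Module (Double k) M] [AddCommGroup N]
    [Module k N] [Module (Double k) N] [IsScalarTower k (Double k) N] (c : k)
    (f f' : M →ₗ[Double k] N) (h : ∀ m, f' m = c • f m) :
    Ext.mk₀ (ModuleCat.ofHom f') = c • Ext.mk₀ (ModuleCat.ofHom f) := by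
  rw [← Ext.mk₀_smul]
  congr 1
  refine ModuleCat.hom_ext (LinearMap.ext fun m => ?_)
  exact (h m).trans (algebraMap_smul (Double k) c (f m)).symm

theorem Dbl.mk₀_pr (e : ℤˣ) (c d : k) : Ext.mk₀ (ModuleCat.ofHom (Dbl.pr e c d)) =
    c • Ext.mk₀ (ModuleCat.ofHom (Dbl.pr e (1 : k) 0)) +
      d • Ext.mk₀ (ModuleCat.ofHom (Dbl.pr e (0 : k) 1)) := by
  have h : Dbl.pr e c d = Dbl.pr e c 0 + Dbl.pr e 0 d := LinearMap.ext fun m => by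
    change c * m.1 + d * m.2 = (c * m.1 + 0 * m.2) + (0 * m.1 + d * m.2)
    ring
  rw [h, ModuleCat.ofHom_add, Ext.mk₀_add, mk₀_ofHom_smul c (Dbl.pr e 1 0) (Dbl.pr e c 0),
    mk₀_ofHom_smul d (Dbl.pr e 0 1) (Dbl.pr e 0 d)]
  · intro m
    change 0 * m.1 + d * m.2 = d * (0 * m.1 + 1 * m.2)
    ring
  · intro m
    change c * m.1 + 0 * m.2 = c * (1 * m.1 + 0 * m.2)
    ring

/-- Weighting the two socle coordinates of `Univ` by `c` and `d` maps it to `Extn e c d`. All the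
classes `eta e c d` are thus pushouts of one class, which makes `eta` linear in `(c, d)` without
Baer sums. -/
theorem omega_comp_pr (e : ℤˣ) (c d : k) :
    (omega k e).comp (Ext.mk₀ (ModuleCat.ofHom (Dbl.pr (-e) c d))) (add_zero 1) = eta e c d := by
  have := extClass_naturality_of (Univ.shortExact (k := k) e) (Extn.shortExact e c d)
    (Dbl.pr (-e) c d)
    (Rep.hom (Univ.rel e) (Extn.rel e c d)
      ((LinearMap.fst k k _).prod ((c • LinearMap.fst k k k + d • LinearMap.snd k k k) ∘ₗ
        LinearMap.snd k k _))
      (by simp [Univ.x, Extn.r]) (by simp [Univ.X, Extn.r])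
      (by simp [Univ.s, Extn.s]; intros; ring)) LinearMap.id
    (fun m => rfl) (fun m => rfl)
  refine this.trans ?_
  exact Ext.mk₀_id_comp _

theorem eta_eq (e : ℤˣ) (c d : k) : eta e c d = c • eta e 1 0 + d • eta e 0 1 := by
  rw [← omega_comp_pr, Dbl.mk₀_pr, Ext.comp_add,
    Ext.comp_smul, Ext.comp_smul, omega_comp_pr, omega_comp_pr]

/-! ### Commutativity of the classes of degree one -/

/-- Over the line of `(c, d)` in the socle of `Univ`, the module `Proj` restricts to the submodule
generated by `c x + d X`. There `x` and `X` give `d` and `-c` times `xX`. -/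
theorem inc_comp_extClass (e : ℤˣ) (c d : k) :
    (Ext.mk₀ (ModuleCat.ofHom (Dbl.inc (-e) c d))).comp
      ((Ext.mk₀ (ModuleCat.ofHom (Univ.i (k := k) e))).comp (Proj.shortExact (k := k) e).extClass
        (zero_add 1))
        (zero_add 1) = eta (-e) d (-c) := by
  rw [Ext.mk₀_comp_mk₀_assoc]
  have := extClass_naturality_of (Extn.shortExact (-e) d (-c)) (Proj.shortExact (k := k) e)
    LinearMap.id
    (Rep.hom (Extn.rel (-e) d (-c)) (Proj.rel e)
      (LinearMap.prod 0 (((c • LinearMap.fst k k k).prod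
        ((d • LinearMap.fst k k k).prod (LinearMap.snd k k k)))))
      (by simp [Proj.x, Extn.r]) (by simp [Proj.X, Extn.r])
      (by simp [Proj.s, Extn.s, sgn_neg, mul_left_comm]))
    (Univ.i e ∘ₗ Dbl.inc (-e) c d)
    (fun m => Prod.ext rfl (Prod.ext (mul_zero c).symm (Prod.ext (mul_zero d).symm rfl)))
    (fun m => rfl)
  refine this.symm.trans ?_
  exact Ext.comp_mk₀_id _

theorem Dbl.id_eq (k : Type u) [Field k] (e : ℤˣ) : 𝟙 (ModuleCat.of (Double k) (Dbl k e)) =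
    ModuleCat.ofHom (Dbl.pr e 1 0) ≫ ModuleCat.ofHom (Dbl.inc e 1 0) +
    ModuleCat.ofHom (Dbl.pr e 0 1) ≫ ModuleCat.ofHom (Dbl.inc e 0 1) := by
  refine ModuleCat.hom_ext (LinearMap.ext fun m => Prod.ext ?_ ?_)
  · change (m.1 : k) = 1 * (1 * m.1 + 0 * m.2) + 0 * (0 * m.1 + 1 * m.2)
    ring
  · change (m.2 : k) = 0 * (1 * m.1 + 0 * m.2) + 1 * (0 * m.1 + 1 * m.2)
    ring

theorem Dbl.ext_eq {e : ℤˣ} {N : ModuleCat.{u} (Double k)} {n : ℕ}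
    (z : Ext.{u} (ModuleCat.of (Double k) (Dbl k e)) N n) :
    z = (Ext.mk₀ (ModuleCat.ofHom (Dbl.pr e (1 : k) 0))).comp
      ((Ext.mk₀ (ModuleCat.ofHom (Dbl.inc e (1 : k) 0))).comp z (zero_add n)) (zero_add n) +
      (Ext.mk₀ (ModuleCat.ofHom (Dbl.pr e (0 : k) 1))).comp
      ((Ext.mk₀ (ModuleCat.ofHom (Dbl.inc e (0 : k) 1))).comp z (zero_add n)) (zero_add n) := by
  rw [Ext.mk₀_comp_mk₀_assoc, Ext.mk₀_comp_mk₀_assoc, ← Ext.add_comp, ← Ext.mk₀_add, ← Dbl.id_eq,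
    Ext.mk₀_id_comp]

/-- The sign in `Xx = -xX` on `Proj` turns into commutativity: the vanishing product of `omega` with
the restricted class of `Proj` expands to `-ab + ba`. -/
theorem eta_comm (k : Type u) [Field k] (e : ℤˣ) :
    (eta e (1 : k) 0).comp (eta (-e) (0 : k) 1) (Nat.add_comm 1 1) =
      (eta e (0 : k) 1).comp (eta (-e) (1 : k) 0) (Nat.add_comm 1 1) := by
  -- The class of a short exact sequence dies when pushed along its own inclusion.
  have h0 : (omega k e).comp ((Ext.mk₀ (ModuleCat.ofHom (Univ.i (k := k) e))).comp
      (Proj.shortExact (k := k) e).extClass (zero_add 1)) rfl = 0 :=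
    ShortComplex.ShortExact.extClass_comp_assoc (Univ.shortExact (k := k) e) _
  have h1 : (Ext.mk₀ (ModuleCat.ofHom (Univ.i (k := k) e))).comp
      (Proj.shortExact (k := k) e).extClass (zero_add 1) =
      (Ext.mk₀ (ModuleCat.ofHom (Dbl.pr (-e) (1 : k) 0))).comp (eta (-e) (0 : k) (-1)) (zero_add 1) +
      (Ext.mk₀ (ModuleCat.ofHom (Dbl.pr (-e) (0 : k) 1))).comp (eta (-e) (1 : k) 0) (zero_add 1) := by
    have := inc_comp_extClass e (0 : k) 1
    rw [neg_zero] at this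
    rw [← inc_comp_extClass, ← this]
    exact Dbl.ext_eq _
  rw [h1, Ext.comp_add] at h0
  have h2 (c d : k) (x : Ext.{u} (SM k (-e)) (SM k (- -e)) 1) : (omega k e).comp
      ((Ext.mk₀ (ModuleCat.ofHom (Dbl.pr (-e) c d))).comp x (zero_add 1)) (Nat.add_comm 1 1) =
      (eta e c d).comp x (Nat.add_comm 1 1) := by
    rw [← omega_comp_pr, Ext.comp_assoc_of_second_deg_zero]
  have h3 : eta (-e) (0 : k) (-1) = -eta (-e) 0 1 := by
    rw [eta_eq, zero_smul, zero_add, neg_smul, one_smul]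
  rw [h2, h2, h3, Ext.comp_neg] at h0
  exact neg_add_eq_zero.1 h0

/-! ### The periodic resolution of `Extn e 1 0` -/

/-- The class of `0 → Extn (-e) 1 0 → Proj e → Extn e 1 0 → 0`. -/
def delta (k : Type u) [Field k] (e : ℤˣ) : Ext.{u} (ModuleCat.of (Double k) (Extn e (1 : k) 0))
    (ModuleCat.of (Double k) (Extn (-e) (1 : k) 0)) 1 :=
  (Proj.shortExact' (k := k) e).extClass

/-- Keeping the coordinates of `1` and `X` maps `Proj e` onto `Extn e 0 1`; hence one step of the
periodic resolution amounts to multiplication by `b`. -/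
theorem delta_comp_p (k : Type u) [Field k] (e : ℤˣ) :
    (delta k e).comp (Ext.mk₀ (ModuleCat.ofHom (Extn.p (-e) 1 0))) (add_zero 1) =
    (Ext.mk₀ (ModuleCat.ofHom (Extn.p e (1 : k) 0))).comp (eta e (0 : k) 1) (zero_add 1) :=
  extClass_naturality_of (Proj.shortExact' (k := k) e) (Extn.shortExact e 0 1) (Extn.p (-e) 1 0)
    (Rep.hom (Proj.rel e) (Extn.rel e 0 1)
      ((LinearMap.fst k k _).prod (LinearMap.fst k k k ∘ₗ LinearMap.snd k k _ ∘ₗ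
        LinearMap.snd k k _))
      (by simp [Proj.x, Extn.r]) (by simp [Proj.X, Extn.r]) (by simp [Proj.s, Extn.s]))
    (Extn.p e (1 : k) 0) (fun m => rfl) (fun m => rfl)

/-- Dimension shifting: the middle term `Proj e` has no extensions in positive degree. -/
theorem exists_delta_comp (h2 : (2 : k) ≠ 0) (e : ℤˣ) {N : ModuleCat.{u} (Double k)} {n : ℕ}
    (z : Ext.{u} (ModuleCat.of (Double k) (Extn e (1 : k) 0)) N (n + 1)) :
    ∃ z' : Ext.{u} (ModuleCat.of (Double k) (Extn (-e) (1 : k) 0)) N n,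
      (delta k e).comp z' (Nat.add_comm 1 n) = z := by
  have := Proj.projective h2 e
  exact Ext.contravariant_sequence_exact₃ (Proj.shortExact' (k := k) e) N z
    (Ext.eq_zero_of_projective _) (Nat.add_comm 1 n)

/-! ### Extensions of simple modules -/

/-- The elements of `S`. -/
def S.mk (e : ℤˣ) (a : k) : S k e := a

theorem S.hom_eq {e t : ℤˣ} (f : S k e →ₗ[Double k] S k t) (a : k) :
    f (S.mk e a) = a • f (S.mk e 1) := by
  have : S.mk e a = algebraMap k (Double k) a • S.mk e 1 := by
    rw [algebraMap_smul]
    exact (mul_one a).symm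
  rw [this, map_smul, algebraMap_smul]

/-- The elements of `Extn`. -/
def Extn.mk (e : ℤˣ) (c d a b : k) : Extn e c d := (a, b)

theorem Extn.x_smul (e : ℤˣ) (c d a b : k) :
    gen k .x • Extn.mk e c d a b = Extn.mk e c d 0 (c * a) := Rep.gen_smul _ _ _ _

theorem Extn.X_smul (e : ℤˣ) (c d a b : k) :
    gen k .X • Extn.mk e c d a b = Extn.mk e c d 0 (d * a) := Rep.gen_smul _ _ _ _

theorem Extn.g_smul (e : ℤˣ) (c d a b : k) :
    gen k .g • Extn.mk e c d a b = Extn.mk e c d (sgn k e * a) (-(sgn k e * b)) :=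
  Rep.gen_smul _ _ _ _

theorem Extn.G_smul (e : ℤˣ) (c d a b : k) :
    gen k .G • Extn.mk e c d a b = Extn.mk e c d (sgn k e * a) (-(sgn k e * b)) :=
  Rep.gen_smul _ _ _ _

theorem Extn.smul_mk (e : ℤˣ) (c d t a b : k) :
    t • Extn.mk e c d a b = Extn.mk e c d (t * a) (t * b) := rfl

theorem Extn.mk_add_mk (e : ℤˣ) (c d a b a' b' : k) :
    Extn.mk e c d a b + Extn.mk e c d a' b' = Extn.mk e c d (a + a') (b + b') := rfl

theorem Extn.mk_fst_snd (e : ℤˣ) (c d : k) (m : Extn e c d) : Extn.mk e c d m.1 m.2 = m := rfl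

theorem Extn.p_mk (e : ℤˣ) (c d a b : k) : Extn.p e c d (Extn.mk e c d a b) = S.mk e a := rfl

/-- The socle is `x` times the generator, and `x` acts as zero on `S t`. -/
theorem Extn.hom_eq {e t : ℤˣ} (f : Extn e (1 : k) 0 →ₗ[Double k] S k t) (a b : k) :
    f (Extn.mk e 1 0 a b) = a • f (Extn.mk e 1 0 1 0) := by
  have h1 : Extn.mk e 1 0 a b = algebraMap k (Double k) a • Extn.mk e 1 0 1 0 +
      algebraMap k (Double k) b • gen k .x • Extn.mk e 1 0 1 0 := by
    simp [Extn.x_smul, algebraMap_smul, Extn.smul_mk, Extn.mk_add_mk]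
  have h0 (v : S k t) : gen k .x • v = 0 :=
    (S_gen_smul t .x v).trans (zero_mul (show k from v))
  rw [h1, map_add, map_smul, map_smul, map_smul, h0, smul_zero, add_zero, algebraMap_smul]

/-- Distinct signs remain distinct eigenvalues of `g` because `2 ≠ 0`. -/
theorem hom_apply_eq_zero (h2 : (2 : k) ≠ 0) {e t : ℤˣ} (h : e ≠ t) {M : Type u} [AddCommGroup M]
    [Module k M]
    [Module (Double k) M] [IsScalarTower k (Double k) M] {m : M} (hm : gen k .g • m = sgn k e • m)
    (f : M →ₗ[Double k] S k t) : f m = 0 := by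
  have h1 : sgn k e * (show k from f m) = sgn k t * (show k from f m) := by
    refine Eq.trans ?_ (S_gen_smul t .g (f m))
    rw [← map_smul, hm, ← algebraMap_smul (Double k) (sgn k e) m, map_smul, algebraMap_smul]
    rfl
  have h3 : sgn k e - sgn k t ≠ 0 := by
    have h4 : ((2 : k) = 0) = False := by simpa using h2
    rcases Int.units_eq_one_or e with rfl | rfl <;> rcases Int.units_eq_one_or t with rfl | rfl <;>
      simp_all [sgn]
    · rwa [one_add_one_eq_two]
    · rwa [← neg_add', neg_eq_zero, one_add_one_eq_two]
  have h5 : (sgn k e - sgn k t) * (show k from f m) = 0 := by rw [sub_mul, h1, sub_self]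
  exact (mul_eq_zero.1 h5).resolve_left h3

open Classical in
/-- The identity of `S e` if `e = t`, and zero otherwise. -/
def idS (k : Type u) [Field k] (e t : ℤˣ) : S k e →ₗ[Double k] S k t :=
  if h : e = t then h ▸ LinearMap.id else 0

theorem idS_self (k : Type u) [Field k] (e : ℤˣ) : idS k e e = LinearMap.id := by simp [idS]

/-- The powers of the class `eta e 0 1`. -/
def etaPow (k : Type u) [Field k] (t : ℤˣ) : (n : ℕ) → (e : ℤˣ) → Ext.{u} (SM k e) (SM k t) n
  | 0, e => Ext.mk₀ (ModuleCat.ofHom (idS k e t))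
  | n + 1, e => (eta e 0 1).comp (etaPow k t n (-e)) (Nat.add_comm 1 n)

/-- By induction along the resolution: each factor `delta` is traded for a factor `b`, and in degree
zero a map to `S t` factors through the top. -/
theorem exists_smul_p_comp (h2 : (2 : k) ≠ 0) (t : ℤˣ) (n : ℕ) : ∀ (e : ℤˣ)
    (z : Ext.{u} (ModuleCat.of (Double k) (Extn e (1 : k) 0)) (SM k t) n), ∃ c : k,
      z = c • (Ext.mk₀ (ModuleCat.ofHom (Extn.p e (1 : k) 0))).comp (etaPow k t n e)
        (zero_add n) := by
  induction n with
  | zero =>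
    intro e z
    obtain ⟨f, rfl⟩ := (Ext.mk₀_bijective _ _).2 z
    rw [etaPow, Ext.mk₀_comp_mk₀]
    by_cases h : e = t
    · subst h
      refine ⟨(show k from f.hom (Extn.mk e 1 0 1 0)),
        mk₀_ofHom_smul _ (idS k e e ∘ₗ Extn.p e 1 0) f.hom fun m => ?_⟩
      rw [idS_self, ← Extn.mk_fst_snd _ _ _ m, LinearMap.comp_apply, Extn.p_mk]
      exact (Extn.hom_eq f.hom m.1 m.2).trans (mul_comm (G := k) _ _)
    · refine ⟨0, mk₀_ofHom_smul _ (idS k e t ∘ₗ Extn.p e 1 0) f.hom fun m => ?_⟩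
      rw [zero_smul, ← Extn.mk_fst_snd _ _ _ m]
      refine (Extn.hom_eq f.hom m.1 m.2).trans ?_
      rw [hom_apply_eq_zero h2 h _ f.hom, smul_zero]
      rw [Extn.g_smul, Extn.smul_mk, mul_zero, neg_zero]
  | succ n ih =>
    intro e z
    obtain ⟨z', rfl⟩ := exists_delta_comp h2 e z
    obtain ⟨c, rfl⟩ := ih (-e) z'
    refine ⟨c, ?_⟩
    rw [Ext.comp_smul, etaPow, ← Ext.comp_assoc_of_second_deg_zero, delta_comp_p]
    congr 1
    exact Ext.comp_assoc _ _ _ _ _ (by omega)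

theorem exists_eta_comp (e : ℤˣ) {N : ModuleCat.{u} (Double k)} {n : ℕ}
    (z : Ext.{u} (SM k e) N (n + 1))
    (hz : (Ext.mk₀ (ModuleCat.ofHom (Extn.p e (1 : k) 0))).comp z (zero_add _) = 0) :
    ∃ z' : Ext.{u} (SM k (-e)) N n, (eta e 1 0).comp z' (Nat.add_comm 1 n) = z :=
  Ext.contravariant_sequence_exact₃ (Extn.shortExact e 1 0) N z hz (Nat.add_comm 1 n)

/-! ### Classes as binary forms -/

/-- The powers of the class `eta e 1 0`. -/
def etaPow' (k : Type u) [Field k] (t : ℤˣ) : (n : ℕ) → (e : ℤˣ) → Ext.{u} (SM k e) (SM k t) n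
  | 0, e => Ext.mk₀ (ModuleCat.ofHom (idS k e t))
  | n + 1, e => (eta e 1 0).comp (etaPow' k t n (-e)) (Nat.add_comm 1 n)

/-- The combination of the products of `n` classes `eta e 1 0` and `eta e 0 1` with the
coefficients of a polynomial. -/
def polyClass (t : ℤˣ) : (n : ℕ) → (p : Polynomial k) → (e : ℤˣ) →
    Ext.{u} (SM k e) (SM k t) n
  | 0, p, e => p.coeff 0 • Ext.mk₀ (ModuleCat.ofHom (idS k e t))
  | n + 1, p, e => (eta e 0 1).comp (polyClass t n p.divX (-e)) (Nat.add_comm 1 n) +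
      p.coeff 0 • etaPow' k t (n + 1) e

theorem polyClass_add (t : ℤˣ) (n : ℕ) : ∀ (p q : Polynomial k) (e : ℤˣ),
    polyClass t n (p + q) e = polyClass t n p e + polyClass t n q e := by
  induction n with
  | zero => intro p q e; simp [polyClass, add_smul]
  | succ n ih =>
    intro p q e
    simp only [polyClass, Polynomial.divX_add, ih, Ext.comp_add, Polynomial.coeff_add, add_smul]
    abel

theorem polyClass_smul (t : ℤˣ) (n : ℕ) : ∀ (c : k) (p : Polynomial k) (e : ℤˣ),
    polyClass t n (c • p) e = c • polyClass t n p e := by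
  induction n with
  | zero => intro c p e; simp [polyClass, mul_smul]
  | succ n ih =>
    intro c p e
    have h : (c • p).divX = c • p.divX := by ext; simp
    simp only [polyClass, h, ih, Ext.comp_smul, Polynomial.coeff_smul, smul_add, smul_eq_mul,
      mul_smul]

theorem polyClass_X_mul (t : ℤˣ) (p : Polynomial k) (e : ℤˣ) (n : ℕ) :
    polyClass t (n + 1) (Polynomial.X * p) e =
      (eta e 0 1).comp (polyClass t n p (-e)) (Nat.add_comm 1 n) := by
  have h : (Polynomial.X * p).divX = p := by ext; simp [Polynomial.coeff_X_mul]
  simp [polyClass, h]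

theorem polyClass_X_pow (t : ℤˣ) (n : ℕ) : ∀ e : ℤˣ,
    polyClass t n (Polynomial.X ^ n : Polynomial k) e = etaPow k t n e := by
  induction n with
  | zero => intro e; simp [polyClass, etaPow]
  | succ n ih => intro e; rw [pow_succ', polyClass_X_mul, ih, etaPow]

/-- Multiplication of a form by `a` does not change its dehomogenised polynomial. The degree bound
ensures that the form of degree `n` on the right truncates no coefficient. -/
theorem polyClass_succ (t : ℤˣ) (n : ℕ) : ∀ (p : Polynomial k) (e : ℤˣ), p.natDegree ≤ n →
    polyClass t (n + 1) p e = (eta e 1 0).comp (polyClass t n p (-e)) (Nat.add_comm 1 n) := by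
  induction n with
  | zero =>
    intro p e hp
    have h : p.divX = 0 := by
      rw [Polynomial.divX_eq_zero_iff]
      exact Polynomial.eq_C_of_natDegree_le_zero hp
    simp [polyClass, h, etaPow']
  | succ n ih =>
    intro p e hp
    have h : p.divX.natDegree ≤ n := by
      rw [Polynomial.natDegree_divX_eq_natDegree_tsub_one]
      omega
    rw [polyClass, ih _ _ h]
    conv_rhs => rw [polyClass, Ext.comp_add, Ext.comp_smul]
    rw [etaPow']
    congr 1
    -- Reassociate to expose the first two factors, then exchange `b` and `a`.
    refine (Ext.comp_assoc _ _ _ (Nat.add_comm 1 1) _ (by omega)).symm.trans ?_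
    rw [← eta_comm]
    exact (Ext.comp_assoc _ _ _ (Nat.add_comm 1 1) _ (by omega))

theorem exists_polyClass (h2 : (2 : k) ≠ 0) (t : ℤˣ) (n : ℕ) : ∀ (e : ℤˣ)
    (z : Ext.{u} (SM k e) (SM k t) n), ∃ p : Polynomial k, p.natDegree ≤ n ∧
      polyClass t n p e = z := by
  induction n with
  | zero =>
    intro e z
    obtain ⟨f, rfl⟩ := (Ext.mk₀_bijective _ _).2 z
    by_cases h : e = t
    · subst h
      refine ⟨Polynomial.C (show k from f.hom (S.mk (k := k) e 1)),
        (Polynomial.natDegree_C _).le, ?_⟩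
      rw [polyClass, Polynomial.coeff_C_zero]
      refine (mk₀_ofHom_smul _ (idS k e e) f.hom fun m => ?_).symm
      rw [idS_self]
      exact (S.hom_eq f.hom m).trans (mul_comm (G := k) _ _)
    · refine ⟨0, by simp, ?_⟩
      rw [polyClass, Polynomial.coeff_zero]
      refine (mk₀_ofHom_smul _ (idS k e t) f.hom fun m => ?_).symm
      rw [zero_smul]
      exact hom_apply_eq_zero h2 h (S_gen_smul (k := k) e .g m) f.hom
  | succ n ih =>
    intro e z
    -- Pulled back to `Extn e 1 0`, the class is a multiple of a power of `b`. This fixes the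
    -- coefficient `c` of `X^(n+1)`, and the difference is divisible by `a`.
    obtain ⟨c, hc⟩ := exists_smul_p_comp h2 t (n + 1) e
      ((Ext.mk₀ (ModuleCat.ofHom (Extn.p e (1 : k) 0))).comp z (zero_add _))
    obtain ⟨z', hz'⟩ := exists_eta_comp e (z - c • etaPow k t (n + 1) e) (by
      rw [sub_eq_add_neg, Ext.comp_add, hc, Ext.comp_neg, Ext.comp_smul, add_neg_cancel])
    obtain ⟨p, hp, rfl⟩ := ih (-e) z'
    refine ⟨p + c • Polynomial.X ^ (n + 1), ?_, ?_⟩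
    · refine (Polynomial.natDegree_add_le _ _).trans (max_le (by omega) ?_)
      exact (Polynomial.natDegree_smul_le _ _).trans (Polynomial.natDegree_X_pow_le _)
    · rw [polyClass_add, polyClass_smul, polyClass_X_pow, polyClass_succ t n p e hp, hz',
        sub_add_cancel]

theorem exists_polyClass_eq_comp [IsAlgClosed k] (t : ℤˣ) (n : ℕ) (p : Polynomial k)
    (hp : p.natDegree ≤ n + 1) (e : ℤˣ) (h0 : polyClass t (n + 1) p e ≠ 0) :
    ∃ (c d : k) (q : Polynomial k), (c, d) ≠ (0, 0) ∧ q.natDegree ≤ n ∧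
      polyClass t (n + 1) p e =
        (eta e c d).comp (polyClass t n q (-e)) (Nat.add_comm 1 n) := by
  -- A drop in degree is a root at infinity, with linear factor `a`.
  rcases hp.lt_or_eq with hp | hp
  · exact ⟨1, 0, p, by simp, by omega, polyClass_succ t n p e (by omega)⟩
  · obtain ⟨r, hr⟩ := IsAlgClosed.exists_root p
      (fun h => by rw [Polynomial.natDegree_eq_of_degree_eq_some (n := 0) h] at hp; omega)
    obtain ⟨q, rfl⟩ := Polynomial.dvd_iff_isRoot.2 hr
    have hq : q ≠ 0 := by rintro rfl; simp at hp
    rw [Polynomial.natDegree_mul (Polynomial.X_sub_C_ne_zero r) hq,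
      Polynomial.natDegree_X_sub_C] at hp
    -- The factor `X - r` stands for the linear form `-r a + b`.
    refine ⟨-r, 1, q, by simp, by omega, ?_⟩
    have h : (Polynomial.X - Polynomial.C r) * q = Polynomial.X * q + (-r) • q := by
      rw [sub_mul, Polynomial.smul_eq_C_mul, Polynomial.C_neg]; ring
    rw [h, polyClass_add, polyClass_X_mul, polyClass_smul, polyClass_succ t n q e (by omega),
      eta_eq e (-r) 1, Ext.add_comp, Ext.smul_comp, one_smul]
    exact add_comm _ _

end Taft

/-! ### Modules induced from the trivial module -/

namespace Induced

variable {k A : Type u} [Field k] [Ring A] [HopfAlgebra k A] (H : Subalgebra k A)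

/-- The basis vector of the trivial module. -/
def one : TrivialMod H := (1 : k)

theorem smul_one_eq (v : TrivialMod H) : (show k from v) • one H = v := mul_one (M := k) v

/-- The generator of the module induced from the trivial module. -/
def gen : Induced H (TrivialMod H) := Submodule.Quotient.mk ((1 : A) ⊗ₜ[k] one H)

theorem smul_gen (h : H) : (h : A) • gen H = Coalgebra.counit (R := k) (h : A) • gen H := by
  refine (Submodule.Quotient.eq _).2 (Submodule.subset_span ⟨1, h, one H, ?_⟩)
  change ((h : A) * 1) ⊗ₜ[k] one H - (Coalgebra.counit (R := k) (h : A) • (1 : A)) ⊗ₜ[k] one H = _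
  rw [one_mul, mul_one, CharMod.smul_def, TensorProduct.smul_tmul]
  rfl

theorem exists_eq_smul_gen (m : Induced H (TrivialMod H)) : ∃ a : A, m = a • gen H := by
  obtain ⟨t, rfl⟩ := Submodule.Quotient.mk_surjective _ m
  induction t using TensorProduct.induction_on with
  | zero => exact ⟨0, by rw [zero_smul]; rfl⟩
  | add s t hs ht =>
    obtain ⟨a, ha⟩ := hs
    obtain ⟨b, hb⟩ := ht
    exact ⟨a + b, by rw [add_smul, ← ha, ← hb]; rfl⟩
  | tmul a v =>
    refine ⟨(show k from v) • a, congrArg Submodule.Quotient.mk ?_⟩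
    change a ⊗ₜ[k] v = (((show k from v) • a) * 1) ⊗ₜ[k] one H
    rw [mul_one, TensorProduct.smul_tmul, smul_one_eq]

variable {M : Type u} [AddCommGroup M] [Module A M]

variable [Module k M]

/-- The homomorphism from the induced module given by an element on which the subalgebra acts
through the counit. -/
def lift [IsScalarTower k A M] (m : M) (hm : ∀ h ∈ H, h • m = Coalgebra.counit (R := k) h • m) :
    Induced H (TrivialMod H) →ₗ[A] M :=
  Submodule.liftQ _ (LinearMap.toSpanSingleton A M m ∘ₗ
    (show (A ⊗[k] TrivialMod H) →ₗ[A] A from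
      (TensorProduct.AlgebraTensorModule.rid k A A).toLinearMap)) (by
    rw [Submodule.span_le]
    rintro _ ⟨a, h, v, rfl⟩
    refine LinearMap.mem_ker.2 ((map_sub _ _ _).trans (sub_eq_zero.2 ?_))
    change ((show k from v) • (a * (h : A))) • m =
      ((Coalgebra.counit (R := k) (h : A) * (show k from v)) • a) • m
    rw [smul_assoc, mul_smul, hm _ h.2, ← algebraMap_smul A _ m, ← mul_smul, ← Algebra.commutes,
      mul_smul, algebraMap_smul, smul_smul, smul_assoc, mul_comm])

theorem lift_gen [IsScalarTower k A M] (m : M)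
    (hm : ∀ h ∈ H, h • m = Coalgebra.counit (R := k) h • m) :
    lift H m hm (gen H) = m := by
  change ((1 : k) • (1 : A)) • m = m
  rw [one_smul, one_smul]

end Induced

/-! ### Two-dimensional extensions as induced modules -/

namespace Taft

variable {k : Type u} [Field k]

theorem Extn.smul_of_mem (c d : k) (h : Double k) (hh : h ∈ subalgH k d (-c)) :
    h • Extn.mk 1 c d 1 0 = Coalgebra.counit (R := k) h • Extn.mk 1 c d 1 0 := by
  rw [counit_apply]
  induction hh using Algebra.adjoin_induction with
  | mem y hy =>
    simp only [Set.mem_insert_iff, Set.mem_singleton_iff] at hy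
    rcases hy with rfl | rfl | rfl
    · rw [Extn.g_smul]
      simp [counitHom, counitGen, sgn]
    · rw [Extn.G_smul]
      simp [counitHom, counitGen, sgn]
    · rw [add_smul, smul_assoc, smul_assoc, Extn.x_smul, Extn.X_smul, Extn.smul_mk, Extn.smul_mk,
        Extn.mk_add_mk]
      simp [counitHom, counitGen, mul_comm]
      rfl
  | algebraMap r => rw [algebraMap_smul, AlgHom.commutes]; rfl
  | add a b _ _ ha hb => rw [add_smul, ha, hb, map_add, add_smul]
  | mul a b _ _ ha hb =>
    rw [mul_smul, hb, ← algebraMap_smul (Double k), ← mul_smul, ← Algebra.commutes, mul_smul, ha,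
      algebraMap_smul, map_mul, mul_comm, mul_smul]

/-- Otherwise `x` and `X` would both kill the generator of `Extn 1 c d`, forcing `c = d = 0`. -/
theorem subalgH_ne_top (c d : k) (h : (c, d) ≠ (0, 0)) : subalgH k d (-c) ≠ ⊤ := by
  intro ht
  have hc := Extn.smul_of_mem c d (gen k .x) (ht ▸ Algebra.mem_top)
  have hd := Extn.smul_of_mem c d (gen k .X) (ht ▸ Algebra.mem_top)
  rw [Extn.x_smul, Extn.smul_mk] at hc
  rw [Extn.X_smul, Extn.smul_mk] at hd
  have hc := congrArg Prod.snd hc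
  have hd := congrArg Prod.snd hd
  simp only [Extn.mk, mul_one, mul_zero] at hc hd
  exact h (Prod.ext hc hd)

section

variable {V : Type u} [AddCommGroup V] [Module k V] [Module (Double k) V]
  [IsScalarTower k (Double k) V]

theorem smul_comm_double (a : Double k) (t : k) (v : V) : a • t • v = t • a • v := by
  rw [← algebraMap_smul (Double k) t v, ← mul_smul, ← Algebra.commutes, mul_smul, algebraMap_smul]

/-- In a module generated by an element `w` fixed by `g` and `G` with `d x w = c X w`, the
elements `x w` and `X w` are multiples of a common element of sign `-1`, killed by `x` and `X`. -/
theorem exists_socle_generator {c d : k} (h : (c, d) ≠ (0, 0)) {w : V} (hg : gen k .g • w = w)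
    (hG : gen k .G • w = w) (hx : d • gen k .x • w = c • gen k .X • w) :
    ∃ y : V, gen k .x • w = c • y ∧ gen k .X • w = d • y ∧
      gen k .x • y = 0 ∧ gen k .X • y = 0 ∧ gen k .g • y = -y ∧ gen k .G • y = -y := by
  have r := gen_satisfiesRel (k := k)
  -- Bézout coefficients, so that `y = p x w + q X w` recovers both `x w = c y` and `X w = d y`.
  obtain ⟨p, q, hpq⟩ : ∃ p q : k, p * c + q * d = 1 := by
    by_cases hc : c = 0
    · have hd : d ≠ 0 := fun hd => h (by rw [hc, hd])
      exact ⟨0, d⁻¹, by simp [hd]⟩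
    · exact ⟨c⁻¹, 0, by simp [hc]⟩
  obtain ⟨y, hy⟩ : ∃ y, p • gen k .x • w + q • gen k .X • w = y := ⟨_, rfl⟩
  have h1 : gen k .x • w = c • y := by
    rw [← hy, smul_add, smul_comm c q, ← hx, smul_smul, smul_smul, ← add_smul, mul_comm c, hpq,
      one_smul]
  have h2 : gen k .X • w = d • y := by
    rw [← hy, smul_add, smul_comm d p, hx, smul_smul, smul_smul, ← add_smul, mul_comm d, hpq,
      one_smul]
  -- Applying `x² = 0`, `X² = 0` and `(xX + Xx) w = (1 - gG) w = 0` gives three equations in `x y`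
  -- and `X y`, which force both to vanish as `(c, d) ≠ (0, 0)`.
  have e1 : c • gen k .x • y = 0 := by
    rw [← smul_comm_double, ← h1, ← mul_smul, r.xx, zero_smul]
  have e2 : d • gen k .X • y = 0 := by
    rw [← smul_comm_double, ← h2, ← mul_smul, r.XX, zero_smul]
  have e3 : d • gen k .x • y + c • gen k .X • y = 0 := by
    rw [← smul_comm_double, ← smul_comm_double, ← h1, ← h2, ← mul_smul, ← mul_smul, ← add_smul,
      r.xX, sub_smul, mul_smul, hG, hg, one_smul, sub_self]
  have e4 : gen k .x • y = 0 ∧ gen k .X • y = 0 := by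
    by_cases hc : c = 0
    · have hd : d ≠ 0 := fun hd => h (by rw [hc, hd])
      have e5 := (smul_eq_zero_iff_right hd).1 e2
      rw [e5, smul_zero, add_zero] at e3
      exact ⟨(smul_eq_zero_iff_right hd).1 e3, e5⟩
    · have e5 := (smul_eq_zero_iff_right hc).1 e1
      rw [e5, smul_zero, zero_add] at e3
      exact ⟨e5, (smul_eq_zero_iff_right hc).1 e3⟩
  refine ⟨y, h1, h2, e4.1, e4.2, ?_, ?_⟩
  · rw [← hy, smul_add, smul_comm_double, smul_comm_double, ← mul_smul, ← mul_smul, r.gx, r.gX,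
      neg_smul, neg_smul, mul_smul, mul_smul, hg, smul_neg, smul_neg, neg_add]
  · rw [← hy, smul_add, smul_comm_double, smul_comm_double, ← mul_smul, ← mul_smul, r.Gx, r.GX,
      neg_smul, neg_smul, mul_smul, mul_smul, hG, smul_neg, smul_neg, neg_add]

end

/-- The relations make `V` a quotient of `Extn 1 c d`, spanned by `w` and `y`, while `F'` shows that
nothing more collapses. This replaces any appeal to the freeness of the double over `H_{αβ}`. -/
theorem Extn.exists_equiv_of_generator {V : Type u} [AddCommGroup V] [Module k V]
    [Module (Double k) V] [IsScalarTower k (Double k) V] {c d : k} (h : (c, d) ≠ (0, 0)) {w : V}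
    (hg : gen k .g • w = w) (hG : gen k .G • w = w) (hx : d • gen k .x • w = c • gen k .X • w)
    (hw : ∀ v : V, ∃ a : Double k, v = a • w) (F' : V →ₗ[Double k] Extn 1 c d)
    (hF' : F' w = Extn.mk 1 c d 1 0) : Nonempty (Extn 1 c d ≃ₗ[Double k] V) := by
  obtain ⟨y, h1, h2, h3, h4, h5, h6⟩ := exists_socle_generator h hg hG hx
  let f : Extn 1 c d →ₗ[k] V :=
    show k × k →ₗ[k] _ from
      (LinearMap.toSpanSingleton k _ w).coprod (LinearMap.toSpanSingleton k _ y)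
  have hf (a b : k) : f (Extn.mk 1 c d a b) = a • w + b • y := rfl
  let F := linOfGen f (by
    intro a m
    rw [← Extn.mk_fst_snd _ _ _ m]
    cases a
    · rw [Extn.x_smul, hf, hf, smul_add, smul_comm_double, smul_comm_double, h1, h3, smul_zero,
        add_zero, zero_smul, zero_add, smul_smul, mul_comm]
    · rw [Extn.X_smul, hf, hf, smul_add, smul_comm_double, smul_comm_double, h2, h4, smul_zero,
        add_zero, zero_smul, zero_add, smul_smul, mul_comm]
    · rw [Extn.g_smul, hf, hf, smul_add, smul_comm_double, smul_comm_double, h5, hg]; simp [sgn]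
    · rw [Extn.G_smul, hf, hf, smul_add, smul_comm_double, smul_comm_double, h6, hG]; simp [sgn])
  have hF : F (Extn.mk 1 c d 1 0) = w := by
    refine (hf 1 0).trans ?_
    rw [one_smul, zero_smul, add_zero]
  have hF'y : F' y = Extn.mk 1 c d 0 1 := by
    have e1 : c • F' y = c • Extn.mk 1 c d 0 1 := by
      rw [← LinearMap.map_smul_of_tower, ← h1, map_smul, hF', Extn.x_smul, Extn.smul_mk, mul_one,
        mul_zero]
    have e2 : d • F' y = d • Extn.mk 1 c d 0 1 := by
      rw [← LinearMap.map_smul_of_tower, ← h2, map_smul, hF', Extn.X_smul, Extn.smul_mk, mul_one,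
        mul_zero]
    by_cases hc : c = 0
    · have hd : d ≠ 0 := fun hd => h (by rw [hc, hd])
      exact smul_right_injective _ hd e2
    · exact smul_right_injective _ hc e1
  refine ⟨LinearEquiv.ofLinearMap F F' ?_ ?_⟩
  · ext v
    obtain ⟨a, rfl⟩ := hw v
    rw [map_smul, map_smul]
    exact congrArg (a • ·) ((congrArg F hF').trans hF)
  · ext m
    change F' (F m) = m
    rw [← Extn.mk_fst_snd _ _ _ m]
    change F' (f _) = _
    rw [hf, map_add, LinearMap.map_smul_of_tower, LinearMap.map_smul_of_tower, hF', hF'y,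
      Extn.smul_mk, Extn.smul_mk, Extn.mk_add_mk]
    simp

theorem Extn.exists_equiv_induced (c d : k) (h : (c, d) ≠ (0, 0)) :
    Nonempty (Extn 1 c d ≃ₗ[Double k]
      Induced (subalgH k d (-c)) (TrivialMod (subalgH k d (-c)))) := by
  have hm (a : Double k) (ha : a ∈ ({gen k .g, gen k .G, d • gen k .x + -c • gen k .X} :
      Set (Double k))) : a • Induced.gen (subalgH k d (-c)) =
        counitHom a • Induced.gen (subalgH k d (-c)) :=
    Induced.smul_gen (subalgH k d (-c)) ⟨a, Algebra.subset_adjoin ha⟩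
  refine Extn.exists_equiv_of_generator h ?_ ?_ ?_ (Induced.exists_eq_smul_gen (subalgH k d (-c)))
    (Induced.lift (subalgH k d (-c)) (Extn.mk 1 c d 1 0) (Extn.smul_of_mem c d))
    (Induced.lift_gen _ _ _)
  · simpa [counitHom, counitGen] using hm (gen k .g) (by simp)
  · simpa [counitHom, counitGen] using hm (gen k .G) (by simp)
  · have := hm (d • gen k .x + -c • gen k .X) (by simp)
    rw [add_smul, smul_assoc, smul_assoc, neg_smul, ← sub_eq_add_neg] at this
    refine sub_eq_zero.1 (this.trans ?_)
    simp [counitHom, counitGen]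

theorem diagAction_gen_tmul {L V : Type u} [AddCommGroup L] [Module k L] [Module (Double k) L]
    [IsScalarTower k (Double k) L] [AddCommGroup V] [Module k V]
    [Module (Double k) V] [IsScalarTower k (Double k) V] (l : L) (v : V) :
    diagAction L V (gen k .x) (l ⊗ₜ[k] v) = l ⊗ₜ (gen k .x • v) + (gen k .x • l) ⊗ₜ (gen k .g • v) ∧
    diagAction L V (gen k .X) (l ⊗ₜ[k] v) = l ⊗ₜ (gen k .X • v) + (gen k .X • l) ⊗ₜ (gen k .G • v) ∧
    diagAction L V (gen k .g) (l ⊗ₜ[k] v) = (gen k .g • l) ⊗ₜ (gen k .g • v) ∧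
    diagAction L V (gen k .G) (l ⊗ₜ[k] v) = (gen k .G • l) ⊗ₜ (gen k .G • v) := by
  have h (a : Gen) : Bialgebra.comulAlgHom k (Double k) (gen k a) = comulGen a :=
    Taft.lift_gen _ comulGen_satisfiesRel a
  refine ⟨?_, ?_, ?_, ?_⟩ <;>
    simp [diagAction, h, comulGen] <;> rfl

/-- Tensoring with `S e` changes the sign of `Extn`. -/
theorem Extn.exists_equiv_diagTensor (e : ℤˣ) (c d : k) {V : Type u} [AddCommGroup V] [Module k V]
    [Module (Double k) V] [IsScalarTower k (Double k) V] (F : Extn 1 c d ≃ₗ[Double k] V) :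
    Nonempty (Extn e c d ≃ₗ[Double k] DiagTensor k (Double k) (S k e) V) := by
  let φ : S k e ⊗[k] V ≃ₗ[k] Extn e c d :=
    (show S k e ⊗[k] V ≃ₗ[k] V from TensorProduct.lid k V).trans
      (show V ≃ₗ[k] Extn e c d from (F.restrictScalars k).symm)
  have hφ (l : k) (a b : k) : φ ((S.mk e l) ⊗ₜ F (Extn.mk 1 c d a b)) =
      Extn.mk e c d (l * a) (l * b) := by
    change F.symm (l • F (Extn.mk 1 c d a b)) = Extn.mk 1 c d (l * a) (l * b)
    rw [← algebraMap_smul (Double k), map_smul, F.symm_apply_apply, algebraMap_smul,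
      Extn.smul_mk]
  have key (a : Double k) : ∀ t, φ (diagAction (S k e) V a t) = a • φ t := by
    induction a using double_induction with
    | h0 c => intro t; rw [AlgHom.commutes, Module.algebraMap_end_apply, map_smul, algebraMap_smul]
    | hm a b ha hb => intro t; rw [map_mul, Module.End.mul_apply, ha, hb, mul_smul]
    | ha a b ha hb => intro t; rw [map_add, LinearMap.add_apply, map_add, ha, hb, add_smul]
    -- On `S e` both `x` and `X` vanish, so only the terms `1 ⊗ x` and `1 ⊗ X` of their
    -- comultiplications act, whereas `g` and `G` acquire the sign `e`.
    | h1 a =>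
      intro t
      induction t using TensorProduct.induction_on with
      | zero => simp
      | add s t hs ht => rw [map_add, map_add, hs, ht, map_add, smul_add]
      | tmul l v =>
        obtain ⟨m, rfl⟩ := F.surjective v
        obtain ⟨l, rfl⟩ : ∃ l' : k, S.mk e l' = l := ⟨l, rfl⟩
        rw [← Extn.mk_fst_snd _ _ _ m]
        generalize (m.1 : k) = r
        generalize (m.2 : k) = s
        obtain ⟨ex, eX, eg, eG⟩ := diagAction_gen_tmul (k := k) (S.mk e l) (F (Extn.mk 1 c d r s))
        have hS (a : Gen) : gen k a • S.mk e l = S.mk e (signGen k e a * l) := S_gen_smul e a l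
        cases a
        · rw [ex, map_add, ← map_smul, ← map_smul, hS, Extn.x_smul, Extn.g_smul, hφ, hφ, hφ,
            Extn.x_smul, Extn.mk_add_mk]
          simp [signGen, mul_left_comm]
        · rw [eX, map_add, ← map_smul, ← map_smul, hS, Extn.X_smul, Extn.G_smul, hφ, hφ, hφ,
            Extn.X_smul, Extn.mk_add_mk]
          simp [signGen, mul_left_comm]
        · rw [eg, ← map_smul, hS, Extn.g_smul, hφ, hφ, Extn.g_smul]
          simp [signGen, sgn, mul_assoc]
        · rw [eG, ← map_smul, hS, Extn.G_smul, hφ, hφ, Extn.G_smul]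
          simp [signGen, sgn, mul_assoc]
  let ψ : DiagTensor k (Double k) (S k e) V →ₗ[Double k] Extn e c d :=
    { toFun := φ
      map_add' := map_add φ
      map_smul' := key }
  exact ⟨(LinearEquiv.ofBijective ψ φ.bijective).symm⟩

/-! ### Splicing the linear factors -/

open Abelian

theorem Extn.isInduced (e : ℤˣ) {c d : k} (h : (c, d) ≠ (0, 0)) :
    ∃ H ∈ familyH k, H ≠ ⊤ ∧
    ∃ (L : Type u) (_ : AddCommGroup L) (_ : Module k L) (_ : Module (Double k) L)
      (_ : IsScalarTower k (Double k) L), Module.Finite k L ∧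
      Nonempty (Extn e c d ≃ₗ[Double k]
        DiagTensor k (Double k) L (Induced H (TrivialMod H))) := by
  obtain ⟨F⟩ := Extn.exists_equiv_induced c d h
  refine ⟨subalgH k d (-c), ⟨d, -c, ?_, rfl⟩, subalgH_ne_top c d h, S k e, inferInstance,
    inferInstance, inferInstance, inferInstance, inferInstanceAs (Module.Finite k k),
    Extn.exists_equiv_diagTensor e c d F⟩
  intro h'
  simp only [Prod.mk.injEq, neg_eq_zero] at h'
  exact h (by rw [h'.1, h'.2])

theorem isOfInducedType_polyClass [IsAlgClosed k] (t : ℤˣ) (n : ℕ) : ∀ (e : ℤˣ)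
    (p : Polynomial k), p.natDegree ≤ n + 1 → polyClass t (n + 1) p e ≠ 0 →
    IsOfInducedType (familyH k) (polyClass t (n + 1) p e) := by
  induction n with
  | zero =>
    intro e p hp h0
    obtain ⟨c, d, q, hcd, hq, he⟩ := exists_polyClass_eq_comp t 0 p hp e h0
    -- An exact sequence has at least one middle term, so the remaining constant `q.coeff 0` is
    -- absorbed into the coordinates of the last extension. If `-e ≠ t`, the degree zero factor is
    -- zero.
    by_cases ht : -e = t
    · subst ht
      have he' : polyClass (-e) 1 p e = eta e (q.coeff 0 * c) (q.coeff 0 * d) := by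
        rw [he, polyClass, idS_self, Ext.comp_smul, eta_eq e (_ * _), mul_smul, mul_smul,
          ← smul_add, ← eta_eq]
        exact congrArg _ (Ext.comp_mk₀_id _)
      have h1 : (q.coeff 0 * c, q.coeff 0 * d) ≠ (0, 0) := fun h => by
        rw [Prod.mk.injEq] at h
        rw [he', h.1, h.2, eta_eq, zero_smul, zero_smul, add_zero] at h0
        exact h0 rfl
      refine ⟨.single _ _ (Extn.w e (q.coeff 0 * c) (q.coeff 0 * d)) (Extn.shortExact e _ _), ?_,
        Extn.isInduced e h1⟩
      rw [he']
      rfl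
    · refine absurd ?_ h0
      rw [he, polyClass, idS, dif_neg ht, ModuleCat.ofHom_zero, Ext.mk₀_zero, smul_zero,
        Ext.comp_zero]
  | succ n ih =>
    intro e p hp h0
    obtain ⟨c, d, q, hcd, hq, he⟩ := exists_polyClass_eq_comp t (n + 1) p hp e h0
    have hq0 : polyClass t (n + 1) q (-e) ≠ 0 := fun h => h0 (by rw [he, h, Ext.comp_zero])
    obtain ⟨T, hT, hT'⟩ := ih (-e) q hq hq0
    refine ⟨.splice _ _ (Extn.w e c d) (Extn.shortExact e c d) T, ?_,
      Extn.isInduced e hcd, hT'⟩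
    rw [he, ← hT]
    rfl


theorem isOfInducedType [IsAlgClosed k] (h2 : (2 : k) ≠ 0) (e t : ℤˣ) (n : ℕ) (hn : 1 ≤ n)
    (z : Ext.{u} (SM k e) (SM k t) n) (hz : z ≠ 0) : IsOfInducedType (familyH k) z := by
  obtain ⟨n, rfl⟩ := Nat.exists_eq_add_of_le' hn
  obtain ⟨p, hp, rfl⟩ := exists_polyClass h2 t (n + 1) e z
  exact isOfInducedType_polyClass t n e p hp hz

end Taft

end

theorem mainTheorem5 (k : Type u) [Field k] [IsAlgClosed k] (h2 : (2 : k) ≠ 0)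
    (n : ℕ) (hn : 1 ≤ n) :
    (∀ ξ : Abelian.Ext.{u} (Taft.plusMod k) (Taft.plusMod k) n, ξ ≠ 0 →
      IsOfInducedType (Taft.familyH k) ξ) ∧
    (∀ ξ : Abelian.Ext.{u} (Taft.plusMod k) (Taft.minusMod k) n, ξ ≠ 0 →
      IsOfInducedType (Taft.familyH k) ξ) ∧
    (∀ ξ : Abelian.Ext.{u} (Taft.minusMod k) (Taft.plusMod k) n, ξ ≠ 0 →
      IsOfInducedType (Taft.familyH k) ξ) ∧
    (∀ ξ : Abelian.Ext.{u} (Taft.minusMod k) (Taft.minusMod k) n, ξ ≠ 0 →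
      IsOfInducedType (Taft.familyH k) ξ) := by
  rw [Taft.plusMod_eq, Taft.minusMod_eq]
  exact ⟨Taft.isOfInducedType h2 _ _ n hn, Taft.isOfInducedType h2 _ _ n hn,
    Taft.isOfInducedType h2 _ _ n hn, Taft.isOfInducedType h2 _ _ n hn⟩
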